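/- Let $q$ be a prime power and $d\ge 1$, and let $\ell,h,k_i,n_i$ ($0\le i\le \ell-1$) be natural numbers with $h\le k_i\le n_i$ and $n_i\ge 2$ for all $i$. Let $G_i\in\mathbb F_q^{k_i\times n_i}$ be Cauchy matrices, that is, $G_i=\big(1/(x_r-y_c)\big)_{r,c}$ with pairwise distinct $x_r$, pairwise distinct $y_c$ and $x_r\ne y_c$ for all $r,c$ (the $x_r,y_c\in\mathbb F_q$ may depend on $i$). Let $\alpha$ be a primitive element of $\mathbb F_{q^d}$ (a generator of $\mathbb F_{q^d}^\times$), and if $h>1$ suppose that $d\ge(\ell-1)\lfloor h/2\rfloor\lceil h/2\rceil+1$. Put $$G=\begin{bmatrix}G_0&&&P_0\\&\ddots&&\vdots\\&&G_{\ell-1}&P_{\ell-1}\end{bmatrix},\qquad P_i=\begin{bmatrix}\mathrm{Diag}(\alpha^0,\alpha^i,\dots,\alpha^{(h-1)i})\\0_{(k_i-h)\times h}\end{bmatrix}.$$ **Theorem (encoding complexity).** A message $m\in\mathbb F_{q^d}^{K}$, $K=k_0+\dots+k_{\ell-1}$, can be encoded as $mG$ with $$O\Big(\sum_{i=0}^{\ell-1}n_i\log^2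 n_i\Big)$$ multiplications in $\mathbb F_{q^d}$, where the implied constant is absolute. Here an encoder is a straight-line program whose steps read a message symbol, read a constant, or add, subtract or multiply two earlier results. All multiplications are counted, including those by constants; additions and subtractions are not counted. The constants are elements of $\mathbb F_{q^d}$ that may be precomputed from the code but not from the message, and the sequence of steps depends only on $\ell,h,(k_i)_i,(n_i)_i$, not on $q$, $d$, $\alpha$, the matrices $G_i$ or the message. -/

import Mathlib

namespace MRLRC

/-! ### The generator matrix -/

/-- A `k × n` matrix over a field is a Cauchy matrix if its `(r, c)` entry is `1 / (x r - y c)`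
for pairwise distinct `x r`, pairwise distinct `y c`, and `x r ≠ y c` for all `r`, `c`. -/
def IsCauchy {F : Type*} [Field F] {k n : ℕ} (A : Matrix (Fin k) (Fin n) F) : Prop :=
  ∃ (x : Fin k → F) (y : Fin n → F), Function.Injective x ∧ Function.Injective y ∧
    (∀ r c, x r ≠ y c) ∧ ∀ r c, A r c = (x r - y c)⁻¹

/-- Indices of message symbols: the `r`-th symbol of the `i`-th information block. -/
abbrev MsgIndex (ℓ : ℕ) (k : Fin ℓ → ℕ) : Type := (i : Fin ℓ) × Fin (k i)

/-- Indices of codeword symbols: the `c`-th symbol of the `i`-th local repair group, or one of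
the `h` global parities. -/
abbrev CodeIndex (ℓ h : ℕ) (n : Fin ℓ → ℕ) : Type := ((i : Fin ℓ) × Fin (n i)) ⊕ Fin h

/-- The parity block `P_i`, with `Diag(α ^ 0, α ^ i, …, α ^ ((h - 1) i))` in the first `h` rows
and zeros below. -/
def parityBlock {K : Type*} [Field K] (α : K) (k h i : ℕ) : Matrix (Fin k) (Fin h) K :=
  Matrix.of fun r c => if (r : ℕ) = (c : ℕ) then α ^ ((c : ℕ) * i) else 0

/-- The generator matrix `[blockdiag(G_0, …, G_{ℓ-1}) | P]` where `P` stacks the parity blocks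
`P_0, …, P_{ℓ-1}`. The blocks `G_i` have entries in the subfield `F` of `K`. -/
def genMatrix {F K : Type*} [Field F] [Field K] [Algebra F K] {ℓ : ℕ} (h : ℕ) {k n : Fin ℓ → ℕ}
    (A : (i : Fin ℓ) → Matrix (Fin (k i)) (Fin (n i)) F) (α : K) :
    Matrix (MsgIndex ℓ k) (CodeIndex ℓ h n) K :=
  Matrix.fromCols
    (Matrix.blockDiagonal' fun i => (A i).map (algebraMap F K))
    (Matrix.of fun (a : MsgIndex ℓ k) (c : Fin h) => parityBlock α (k a.1) h (a.1 : ℕ) a.2 c)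

/-! ### Straight-line programs -/

/-- One step of a straight-line program. A step reads a message symbol (indexed by `M`), reads a
precomputed constant, or combines the results of the earlier steps number `a` and `b`. -/
inductive Step (M : Type*) where
  | msg (i : M) : Step M
  | const (j : ℕ) : Step M
  | add (a b : ℕ) : Step M
  | sub (a b : ℕ) : Step M
  | mul (a b : ℕ) : Step M

/-- Is the step a multiplication? Multiplications by constants count as well. -/
def Step.isMul {M : Type*} : Step M → Bool
  | .mul _ _ => true
  | _ => false

/-- The result of a step, given the table of constants `w`, the message `m` and the list `v` of the
results of all earlier steps. The result of a step that has not been executed reads as `0`. -/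
def Step.value {M R : Type*} [Ring R] (w : ℕ → R) (m : M → R) (v : List R) : Step M → R
  | .msg i => m i
  | .const j => w j
  | .add a b => v.getD a 0 + v.getD b 0
  | .sub a b => v.getD a 0 - v.getD b 0
  | .mul a b => v.getD a 0 * v.getD b 0

/-- Execute a list of steps in order, starting from the list `v` of earlier results, and return
the list of all results. -/
def runSteps {M R : Type*} [Ring R] (w : ℕ → R) (m : M → R) : List (Step M) → List R → List R
  | [], v => v
  | s :: l, v => runSteps w m l (v ++ [s.value w m v])

/-- A straight-line program for encoding: a finite list of steps and, for every codeword symbol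
(indexed by `C`), the number of the step whose result is that symbol. The program is a purely
combinatorial object: field elements enter only through the message and the table of constants. -/
structure Program (M C : Type*) where
  steps : List (Step M)
  out : C → ℕ

/-- The output of a program on the message `m`, with table of constants `w`. -/
def Program.eval {M C R : Type*} [Ring R] (P : Program M C) (w : ℕ → R) (m : M → R) : C → R :=
  fun c => (runSteps w m P.steps []).getD (P.out c) 0

/-- The number of multiplications that a program performs. -/
def Program.mulCount {M C : Type*} (P : Program M C) : ℕ := P.steps.countP Step.isMul

end MRLRC

namespace MRLRC

section Algebra

open Polynomial Finset

/-! ### Integer bilinear algorithms for the multiplication in cyclotomic rings -/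

/-! Additions are free, so multiplication by a fixed integer is free too. What is known after some
steps is therefore an additive subgroup of the functions of the message, and each multiplication by
a constant adjoins one generator (`Gen`, `Computes`).

Over an arbitrary ring there need be no roots of unity for an FFT. Polynomial multiplication is
instead done by bilinear algorithms over ℤ, which specialize to every commutative ring. In the ring
of integers of a cyclotomic field of conductor a power of p, multiplication by a root of unity is
ℤ-linear, hence free. A transform of about square root length reduces a product there to products in
a much smaller cyclotomic ring (`HasRank.step`). Since transforms cost nothing, the count solves to
O(n log n). The recursion yields the product only up to a power of p; running it for p = 2 and p = 3
and combining the outputs by Bézout removes the factor without division (`polyRank_two_pow`).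

For a Cauchy block, ∑ u_r / (x_r - y_c) equals N(y_c) / ∏ (x_r - y_c), where N is the numerator of ∑
u_r / (x_r - X). A product tree computes N, and a scaled remainder tree evaluates it at all y_c. In
every product one factor depends only on the code, so a bilinear algorithm of rank r costs r
multiplications by constants. There are O(log n) levels of cost O(n log n) each (`computes_cauchy`).
The parity part has only ℓh nonzero entries, and ℓh ≤ ∑ n_i.

The argument uses only that the x_r - y_c are invertible, so it works over a product of fields. One
program over the product of all fields projects to each of them, so its steps do not depend on the
field or the code (`exists_uniform_encoder`). -/

/-- `HasRank S s r`: the multiplication of the ring `S`, scaled by `s`, is computed by a bilinear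
algorithm over `ℤ` with at most `r` multiplications. -/
def HasRank (S : Type) [CommRing S] (s r : ℕ) : Prop :=
  ∃ (ι : Type) (_ : Fintype ι) (φ ψ : ι → S →+ ℤ) (γ : ι → S), Fintype.card ι ≤ r ∧
    ∀ a b : S, (s : S) * (a * b) = ∑ t, ((φ t a * ψ t b : ℤ) : S) * γ t

/-- The map `rep` reads off the coefficients, of degree less than `d`, of elements of `ℤ[ζ]`. -/
structure IsCoeffMap {S : Type} [CommRing S] (d : ℕ) (ζ : S) (rep : S →+ ℤ[X]) : Prop where
  degree_lt : ∀ a, (rep a).degree < d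
  aeval_rep : ∀ a, aeval ζ (rep a) = a
  rep_aeval : ∀ f : ℤ[X], f.degree < d → rep (aeval ζ f) = f

/-! ### Ramanujan sums and the inverse transform. -/

/-- The sum of `ω ^ (t * m)` over the `t < p * b` prime to `p`, where `ω` is a primitive root of
unity of order `p * b`. -/
def ramanujanSum (p b m : ℕ) : ℤ :=
  if b ∣ m then (if p * b ∣ m then (b : ℤ) * (p - 1) else -b) else 0

theorem ramanujanSum_add_period (p b m : ℕ) :
    ramanujanSum p b (m + p * b) = ramanujanSum p b m := by
  unfold ramanujanSum
  have h1 : b ∣ m + p * b ↔ b ∣ m := (Nat.dvd_add_left (Dvd.intro_left p rfl))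
  have h2 : p * b ∣ m + p * b ↔ p * b ∣ m := (Nat.dvd_add_left (dvd_refl _))
  simp only [h1, h2]

/-- The double sum factors as (∑ ω^(pms)) (∑ ω^(mc) - 1), with s < b and c < p. Each geometric sum
vanishes unless its ratio is 1. -/
theorem sum_pow_eq_ramanujanSum {S : Type*} [CommRing S] [IsDomain S] {p b : ℕ} (hp : 2 ≤ p)
    {ω : S} (hω : IsPrimitiveRoot ω (p * b)) (m : ℕ) :
    ∑ s ∈ range b, ∑ c ∈ range (p - 1), ω ^ ((p * s + (c + 1)) * m)
      = ((ramanujanSum p b m : ℤ) : S) := by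
  have hfac : ∑ s ∈ range b, ∑ c ∈ range (p - 1), ω ^ ((p * s + (c + 1)) * m)
      = (∑ s ∈ range b, (ω ^ (p * m)) ^ s) * ((∑ c ∈ range p, (ω ^ m) ^ c) - 1) := by
    have h1 : (∑ c ∈ range p, (ω ^ m) ^ c) - 1 = ∑ c ∈ range (p - 1), (ω ^ m) ^ (c + 1) := by
      obtain ⟨p', rfl⟩ : ∃ p', p = p' + 1 := ⟨p - 1, by omega⟩
      rw [sum_range_succ']
      simp
    rw [h1, sum_mul_sum]
    refine sum_congr rfl fun s _ => sum_congr rfl fun c _ => ?_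
    rw [← pow_mul, ← pow_mul, ← pow_add]
    congr 1
    ring
  rw [hfac]
  have hp0 : 0 < p := by omega
  have key : ∀ (z : S) (n : ℕ), z ^ n = 1 → z ≠ 1 → ∑ s ∈ range n, z ^ s = 0 := by
    intro z n hz hz1
    have := mul_geom_sum z n
    rw [hz, sub_self] at this
    exact (mul_eq_zero.1 this).resolve_left (sub_ne_zero.2 hz1)
  unfold ramanujanSum
  split_ifs with h1 h2
  · have e1 : ω ^ (p * m) = 1 := (hω.pow_eq_one_iff_dvd _).2 (mul_dvd_mul_left p h1)
    have e2 : ω ^ m = 1 := (hω.pow_eq_one_iff_dvd _).2 h2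
    simp [e1, e2]
  · have e1 : ω ^ (p * m) = 1 := (hω.pow_eq_one_iff_dvd _).2 (mul_dvd_mul_left p h1)
    have e2 : ω ^ m ≠ 1 := fun h => h2 ((hω.pow_eq_one_iff_dvd _).1 h)
    have e3 : (ω ^ m) ^ p = 1 := by rw [← pow_mul, mul_comm, e1]
    rw [key _ _ e3 e2]
    simp [e1]
  · have e1 : ω ^ (p * m) ≠ 1 := fun h =>
      h1 (Nat.dvd_of_mul_dvd_mul_left hp0 ((hω.pow_eq_one_iff_dvd _).1 h))
    have e3 : (ω ^ (p * m)) ^ b = 1 := by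
      rw [← pow_mul]
      exact (hω.pow_eq_one_iff_dvd _).2 ⟨m, by ring⟩
    rw [key _ _ e3 e1]
    simp

/-- Inversion of a transform that uses only the exponents prime to p. At n = 0 the Ramanujan sum is
pb·[pb ∣ l] - b·[b ∣ l], and the second term is killed by the cyclotomic relation `hsum`.
Periodicity in l then gives the shift from n to n + 1. Nothing is divided by pb, which is why
scaling factors accumulate. -/
theorem sum_ramanujanSum_mul_pow {S : Type*} [CommRing S] {p b : ℕ} (hb : 0 < b)
    (hp : 0 < p) {Y η : S} (hY : Y * η = 1) (hη : η ^ (p * b) = 1)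
    (hsum : ∑ c ∈ range p, (η ^ b) ^ c = 0) (n : ℕ) :
    ∑ l ∈ range (p * b), ((ramanujanSum p b (n + l) : ℤ) : S) * η ^ l
      = ((p * b : ℕ) : S) * Y ^ n := by
  induction n with
  | zero =>
    have h1 : ∀ l ∈ range (p * b), ((ramanujanSum p b (0 + l) : ℤ) : S) * η ^ l
        = if b ∣ l then (if p * b ∣ l then ((p * b : ℕ) : S) else 0) - (b : S) * η ^ l else 0 := by
      intro l hl
      rw [mem_range] at hl
      unfold ramanujanSum
      rw [zero_add]
      split_ifs with h1 h2
      · obtain rfl := Nat.eq_zero_of_dvd_of_lt h2 hl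
        push_cast
        ring
      · push_cast
        ring
      · simp
    rw [sum_congr rfl h1, ← sum_filter]
    have h2 : (range (p * b)).filter (fun l => b ∣ l) = (range p).image (fun c => b * c) := by
      ext l
      simp only [mem_filter, mem_range, mem_image]
      constructor
      · rintro ⟨hl, c, rfl⟩
        refine ⟨c, ?_, rfl⟩
        rw [mul_comm p b] at hl
        exact lt_of_mul_lt_mul_left hl (Nat.zero_le b)
      · rintro ⟨c, hc, rfl⟩
        exact ⟨by rw [mul_comm p b]; exact Nat.mul_lt_mul_of_pos_left hc hb, dvd_mul_right _ _⟩
    rw [h2, sum_image fun x _ y _ h => Nat.eq_of_mul_eq_mul_left hb h, sum_sub_distrib]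
    have h3 : ∑ c ∈ range p, (b : S) * η ^ (b * c) = 0 := by
      rw [← mul_sum]
      simp only [pow_mul]
      rw [hsum, mul_zero]
    rw [h3, sum_eq_single 0]
    · simp
    · intro c hc hc0
      rw [mem_range] at hc
      rw [if_neg]
      intro h
      rw [mul_comm p b] at h
      exact hc0 (Nat.eq_zero_of_dvd_of_lt (Nat.dvd_of_mul_dvd_mul_left hb h) hc)
    · intro h
      exact absurd (mem_range.2 hp) h
  | succ n ih =>
    rw [pow_succ, ← mul_assoc, ← ih]
    set f : ℕ → S := fun l => ((ramanujanSum p b (n + l) : ℤ) : S) * (η ^ l * Y) with hf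
    have h1 : ∀ l, ((ramanujanSum p b (n + 1 + l) : ℤ) : S) * η ^ l = f (l + 1) := by
      intro l
      simp only [hf]
      rw [pow_succ, mul_assoc (η ^ l), mul_comm η, hY, mul_one]
      congr 3
      ring
    have h2 : f (p * b) = f 0 := by
      simp only [hf]
      rw [ramanujanSum_add_period, hη]
      simp
    have h3 : ∑ l ∈ range (p * b), f (l + 1) = ∑ l ∈ range (p * b), f l := by
      have := sum_range_succ f (p * b)
      rw [sum_range_succ' f, h2] at this
      exact add_right_cancel this
    rw [sum_congr rfl fun l _ => h1 l, h3, sum_mul]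
    exact sum_congr rfl fun l _ => by simp only [hf]; ring

theorem sum_range_mul' {M : Type*} [AddCommMonoid M] (a B : ℕ) (f : ℕ → M) :
    ∑ n ∈ range (B * a), f n = ∑ i ∈ range B, ∑ j ∈ range a, f (a * i + j) := by
  induction B with
  | zero => simp
  | succ B ih => rw [Nat.succ_mul, sum_range_add, ih, sum_range_succ, mul_comm B a]

/-- The coefficients of `X ^ (a * i), …, X ^ (a * i + a - 1)`, as a polynomial of degree `< a`. -/
noncomputable def coeffBlock (a i : ℕ) : ℤ[X] →+ ℤ[X] where
  toFun f := ∑ j ∈ range a, monomial j (f.coeff (a * i + j))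
  map_zero' := by simp
  map_add' f g := by simp [sum_add_distrib]

theorem coeffBlock_degree_lt (a i : ℕ) (f : ℤ[X]) : (coeffBlock a i f).degree < a := by
  change (∑ j ∈ range a, monomial j (f.coeff (a * i + j))).degree < a
  refine (degree_sum_le _ _).trans_lt ((Finset.sup_lt_iff (WithBot.bot_lt_coe a)).2 ?_)
  intro j hj
  exact (degree_monomial_le _ _).trans_lt (Nat.cast_lt.2 (mem_range.1 hj))

theorem aeval_eq_sum_coeffBlock {S : Type*} [CommRing S] (ζ : S) (a B : ℕ) (f : ℤ[X])
    (hf : f.degree < (B * a : ℕ)) :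
    aeval ζ f = ∑ i ∈ range B, aeval ζ (coeffBlock a i f) * (ζ ^ a) ^ i := by
  have h1 : ∀ i, aeval ζ (coeffBlock a i f) * (ζ ^ a) ^ i
      = ∑ j ∈ range a, (f.coeff (a * i + j) : S) * ζ ^ (a * i + j) := by
    intro i
    change aeval ζ (∑ j ∈ range a, monomial j (f.coeff (a * i + j))) * _ = _
    rw [map_sum, sum_mul]
    refine sum_congr rfl fun j _ => ?_
    rw [aeval_monomial, pow_add, pow_mul]
    simp only [algebraMap_int_eq, eq_intCast]
    ring
  rw [sum_congr rfl fun i _ => h1 i, ← sum_range_mul' a B fun n => (f.coeff n : S) * ζ ^ n]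
  by_cases h0 : f = 0
  · simp [h0]
  · rw [aeval_eq_sum_range' (n := B * a) ((natDegree_lt_iff_degree_lt h0).2 hf)]
    simp

/-- One step of the Schönhage–Cantor–Kaltofen recursion. -/
theorem HasRank.step {S T : Type} [CommRing S] [CommRing T] [IsDomain T] {p a b d e s r : ℕ}
    (hp : 2 ≤ p) (hb : 0 < b) {ζ : S} {repS : S →+ ℤ[X]}
    (hS : IsCoeffMap d ζ repS) (hd : d = (p - 1) * b * a)
    (hζ : ζ ^ (a * (p * b)) = 1)
    (hζ' : ∑ c ∈ range p, (ζ ^ (a * b * (p * b - 1))) ^ c = 0)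
    {ξ : T} {repT : T →+ ℤ[X]} (hT : IsCoeffMap e ξ repT) (he : 2 * a ≤ e + 1)
    {ω : T} (hω : IsPrimitiveRoot ω (p * b)) (h : HasRank T s r) :
    HasRank S (s * (p * b)) (b * (p - 1) * r) := by
  obtain ⟨ι, _, φ, ψ, γ, hcard, hφ⟩ := h
  -- This map replaces ξ by ζ and is only additive. It is still multiplicative on products of two
  -- blocks: their degree is at most 2a - 2 < e, so no reduction takes place in T.
  set lift : T →+ S := (aeval ζ : ℤ[X] →ₐ[ℤ] S).toRingHom.toAddMonoidHom.comp repT with hlift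
  have hlift' : ∀ f : ℤ[X], f.degree < e → lift (aeval ξ f) = aeval ζ f := by
    intro f hf
    change aeval ζ (repT (aeval ξ f)) = _
    rw [hT.rep_aeval f hf]
  set B := (p - 1) * b with hB
  -- The inverse of Y = ζ^a. Elements of S are regarded as polynomials in Y of degree less than B,
  -- with blocks of length a as coefficients.
  set η : S := ζ ^ (a * (p * b - 1)) with hη
  have hpb : 0 < p * b := Nat.mul_pos (by omega) hb
  have hη1 : η ^ (p * b) = 1 := by
    rw [hη, ← pow_mul, show a * (p * b - 1) * (p * b) = a * (p * b) * (p * b - 1) by ring,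
      pow_mul, hζ, one_pow]
  have hYη : ζ ^ a * η = 1 := by
    rw [hη, ← pow_add, ← hζ]
    congr 1
    obtain ⟨q, hq⟩ : ∃ q, p * b = q + 1 := ⟨p * b - 1, by omega⟩
    rw [hq, Nat.add_sub_cancel]
    ring
  have hηs : ∑ c ∈ range p, (η ^ b) ^ c = 0 := by
    rw [← hζ', hη, ← pow_mul]
    exact sum_congr rfl fun c _ => by ring
  -- evaluation at the power `t` of `ω`
  set blk : ℕ → S →+ T := fun i =>
    (aeval ξ : ℤ[X] →ₐ[ℤ] T).toRingHom.toAddMonoidHom.comp ((coeffBlock a i).comp repS) with hblk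
  have hblk' : ∀ i x, blk i x = aeval ξ (coeffBlock a i (repS x)) := fun _ _ => rfl
  set ev : ℕ → S →+ T := fun t =>
    ∑ i ∈ range B, (AddMonoidHom.mulRight (ω ^ (t * i))).comp (blk i) with hev
  have hev' : ∀ t x, ev t x = ∑ i ∈ range B, blk i x * ω ^ (t * i) := by
    intro t x
    simp [hev]
  -- The (p - 1) b exponents below pb that are prime to p; each costs one multiplication in T.
  let pt : Fin b × Fin (p - 1) → ℕ := fun x => p * x.1 + (x.2 + 1)
  refine ⟨(Fin b × Fin (p - 1)) × ι, inferInstance, fun x => (φ x.2).comp (ev (pt x.1)),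
    fun x => (ψ x.2).comp (ev (pt x.1)),
    fun x => ∑ l ∈ range (p * b), lift (ω ^ (pt x.1 * l) * γ x.2) * η ^ l, ?_, ?_⟩
  · simp only [Fintype.card_prod, Fintype.card_fin]
    exact Nat.mul_le_mul_left _ hcard
  intro x y
  have hprod : ∀ i j, lift (blk i x * blk j y)
      = aeval ζ (coeffBlock a i (repS x)) * aeval ζ (coeffBlock a j (repS y)) := by
    intro i j
    rw [hblk', hblk', ← map_mul, hlift', map_mul]
    have h1 := coeffBlock_degree_lt a i (repS x)
    have h2 := coeffBlock_degree_lt a j (repS y)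
    set f := coeffBlock a i (repS x)
    set g := coeffBlock a j (repS y)
    by_cases hf : f = 0
    · simp [hf]
    by_cases hg : g = 0
    · simp [hg]
    rw [degree_eq_natDegree hf] at h1
    rw [degree_eq_natDegree hg] at h2
    rw [degree_mul, degree_eq_natDegree hf, degree_eq_natDegree hg]
    have h1' : f.natDegree < a := by exact_mod_cast h1
    have h2' : g.natDegree < a := by exact_mod_cast h2
    have : f.natDegree + g.natDegree < e := by omega
    exact_mod_cast this
  have hsumι : ∀ (t l : ℕ), ∑ τ, ((φ τ (ev t x) * ψ τ (ev t y) : ℤ) : S) *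
      lift (ω ^ (t * l) * γ τ) = lift (ω ^ (t * l) * ((s : T) * (ev t x * ev t y))) := by
    intro t l
    rw [hφ, mul_sum, map_sum]
    refine sum_congr rfl fun τ _ => ?_
    rw [← zsmul_eq_mul, ← map_zsmul, zsmul_eq_mul]
    congr 1
    ring
  -- Summation over all evaluation points turns the powers of ω into integers, and these pass
  -- through the merely additive `lift`.
  have hsump : ∀ l, ∑ u : Fin b × Fin (p - 1), ω ^ (pt u * l) *
      ((s : T) * (ev (pt u) x * ev (pt u) y))
      = ∑ i ∈ range B, ∑ j ∈ range B, (s * ramanujanSum p b (i + j + l) : ℤ) •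
        (blk i x * blk j y) := by
    intro l
    have h1 : ∀ u : Fin b × Fin (p - 1), ω ^ (pt u * l) * ((s : T) * (ev (pt u) x * ev (pt u) y))
        = ∑ i ∈ range B, ∑ j ∈ range B, (s : T) * (blk i x * blk j y) *
          ω ^ (pt u * (i + j + l)) := by
      intro u
      rw [hev', hev', sum_mul_sum, mul_sum, mul_sum]
      refine sum_congr rfl fun i _ => ?_
      rw [mul_sum, mul_sum]
      refine sum_congr rfl fun j _ => ?_
      rw [mul_add, mul_add, pow_add, pow_add]
      ring
    rw [sum_congr rfl fun u _ => h1 u, sum_comm]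
    refine sum_congr rfl fun i _ => ?_
    rw [sum_comm]
    refine sum_congr rfl fun j _ => ?_
    rw [← mul_sum, zsmul_eq_mul]
    push_cast
    rw [← sum_pow_eq_ramanujanSum hp hω, Fintype.sum_prod_type]
    rw [← Fin.sum_univ_eq_sum_range
      (fun s => ∑ c ∈ range (p - 1), ω ^ ((p * s + (c + 1)) * (i + j + l))) b]
    have h2 : ∀ s : ℕ, ∑ c ∈ range (p - 1), ω ^ ((p * s + (c + 1)) * (i + j + l))
        = ∑ c : Fin (p - 1), ω ^ ((p * s + (c + 1)) * (i + j + l)) := fun s =>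
      (Fin.sum_univ_eq_sum_range (fun c => ω ^ ((p * s + (c + 1)) * (i + j + l))) (p - 1)).symm
    simp only [h2]
    ring
  calc ((s * (p * b) : ℕ) : S) * (x * y)
      = ∑ i ∈ range B, ∑ j ∈ range B, (s : S) * (((p * b : ℕ) : S) * (ζ ^ a) ^ (i + j)) *
          lift (blk i x * blk j y) := by
        have hx := aeval_eq_sum_coeffBlock ζ a B (repS x) (by rw [← hd]; exact hS.degree_lt x)
        have hy := aeval_eq_sum_coeffBlock ζ a B (repS y) (by rw [← hd]; exact hS.degree_lt y)
        rw [hS.aeval_rep] at hx hy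
        conv_lhs => rw [hx, hy]
        rw [sum_mul_sum, mul_sum]
        refine sum_congr rfl fun i _ => ?_
        rw [mul_sum]
        refine sum_congr rfl fun j _ => ?_
        rw [hprod, pow_add]
        push_cast
        ring
    _ = ∑ l ∈ range (p * b), lift (∑ u : Fin b × Fin (p - 1), ω ^ (pt u * l) *
          ((s : T) * (ev (pt u) x * ev (pt u) y))) * η ^ l := by
        have h3 : ∀ l, lift (∑ u : Fin b × Fin (p - 1), ω ^ (pt u * l) *
            ((s : T) * (ev (pt u) x * ev (pt u) y))) * η ^ l
            = ∑ i ∈ range B, ∑ j ∈ range B, (s : S) * lift (blk i x * blk j y) *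
              (((ramanujanSum p b (i + j + l) : ℤ) : S) * η ^ l) := by
          intro l
          rw [hsump, map_sum, sum_mul]
          refine sum_congr rfl fun i _ => ?_
          rw [map_sum, sum_mul]
          refine sum_congr rfl fun j _ => ?_
          rw [map_zsmul, zsmul_eq_mul]
          push_cast
          ring
        symm
        rw [sum_congr rfl fun l _ => h3 l, sum_comm]
        refine sum_congr rfl fun i _ => ?_
        rw [sum_comm]
        refine sum_congr rfl fun j _ => ?_
        rw [← mul_sum, sum_ramanujanSum_mul_pow hb (by omega) hYη hη1 hηs]
        ring
    _ = _ := by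
        rw [Fintype.sum_prod_type]
        have h4 : ∀ (u : Fin b × Fin (p - 1)) (τ : ι),
            ((((φ τ).comp (ev (pt u))) x * ((ψ τ).comp (ev (pt u))) y : ℤ) : S) *
              ∑ l ∈ range (p * b), lift (ω ^ (pt u * l) * γ τ) * η ^ l
            = ∑ l ∈ range (p * b), ((φ τ (ev (pt u) x) * ψ τ (ev (pt u) y) : ℤ) : S) *
              lift (ω ^ (pt u * l) * γ τ) * η ^ l := by
          intro u τ
          rw [mul_sum]
          exact sum_congr rfl fun l _ => by simp only [AddMonoidHom.comp_apply]; ring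
        simp only [h4]
        have h5 : ∀ u : Fin b × Fin (p - 1), ∑ τ, ∑ l ∈ range (p * b),
            ((φ τ (ev (pt u) x) * ψ τ (ev (pt u) y) : ℤ) : S) *
              lift (ω ^ (pt u * l) * γ τ) * η ^ l
            = ∑ l ∈ range (p * b), lift (ω ^ (pt u * l) * ((s : T) * (ev (pt u) x * ev (pt u) y)))
              * η ^ l := by
          intro u
          rw [sum_comm]
          refine sum_congr rfl fun l _ => ?_
          rw [← sum_mul, hsumι]
        rw [sum_congr rfl fun u _ => h5 u, sum_comm]
        refine sum_congr rfl fun l _ => ?_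
        rw [map_sum, sum_mul]

/-! ### Cyclotomic rings of prime power conductor and the recursion on the exponent. -/

/-- The ring of integers of the cyclotomic field of conductor `p ^ (k + 1)`, as `ℤ[ζ]`. -/
abbrev CycRing (p k : ℕ) : Type := AdjoinRoot (cyclotomic (p ^ (k + 1)) ℤ)

theorem CycRing.isDomain {p : ℕ} (hp : p.Prime) (k : ℕ) : IsDomain (CycRing p k) :=
  AdjoinRoot.isDomain_of_prime (cyclotomic.irreducible (pow_pos hp.pos _)).prime

theorem CycRing.degree_eq {p : ℕ} (hp : p.Prime) (k : ℕ) :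
    (cyclotomic (p ^ (k + 1)) ℤ).degree = (((p - 1) * p ^ k : ℕ) : WithBot ℕ) := by
  rw [degree_cyclotomic, Nat.totient_prime_pow_succ hp, mul_comm]

theorem CycRing.isPrimitiveRoot {p : ℕ} (hp : p.Prime) (k : ℕ) :
    IsPrimitiveRoot (AdjoinRoot.root (cyclotomic (p ^ (k + 1)) ℤ) : CycRing p k)
      (p ^ (k + 1)) := by
  have := CycRing.isDomain hp k
  have hinj : Function.Injective (AdjoinRoot.of (cyclotomic (p ^ (k + 1)) ℤ)) := by
    apply AdjoinRoot.of.injective_of_degree_ne_zero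
    rw [CycRing.degree_eq hp]
    have : (p - 1) * p ^ k ≠ 0 :=
      mul_ne_zero (by have := hp.two_le; omega) (pow_ne_zero _ hp.ne_zero)
    exact_mod_cast this
  have : NeZero ((p ^ (k + 1) : ℕ) : CycRing p k) := by
    refine ⟨fun h => ?_⟩
    have h1 : AdjoinRoot.of (cyclotomic (p ^ (k + 1)) ℤ) ((p ^ (k + 1) : ℕ) : ℤ) = 0 := by
      rw [map_natCast]
      exact h
    rw [← map_zero (AdjoinRoot.of (cyclotomic (p ^ (k + 1)) ℤ))] at h1
    have h2 := hinj h1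
    exact pow_ne_zero (k + 1) hp.ne_zero (by exact_mod_cast h2)
  rw [← isRoot_cyclotomic_iff]
  have := AdjoinRoot.isRoot_root (cyclotomic (p ^ (k + 1)) ℤ)
  rwa [map_cyclotomic] at this

theorem CycRing.isCoeffMap {p : ℕ} (hp : p.Prime) (k : ℕ) :
    IsCoeffMap ((p - 1) * p ^ k) (AdjoinRoot.root (cyclotomic (p ^ (k + 1)) ℤ) : CycRing p k)
      (AdjoinRoot.modByMonicHom (cyclotomic.monic (p ^ (k + 1)) ℤ)).toAddMonoidHom := by
  have hm := cyclotomic.monic (p ^ (k + 1)) ℤ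
  have eval_eq : ∀ f : ℤ[X], eval₂ (Int.castRingHom (CycRing p k))
      (AdjoinRoot.root (cyclotomic (p ^ (k + 1)) ℤ)) f = AdjoinRoot.mk _ f := by
    intro f
    rw [← AdjoinRoot.aeval_eq, aeval_def, RingHom.ext_int (algebraMap ℤ _)]
  refine ⟨fun a => ?_, fun a => ?_, fun f hf => ?_⟩
  · obtain ⟨f, rfl⟩ := AdjoinRoot.mk_surjective a
    rw [LinearMap.toAddMonoidHom_coe, AdjoinRoot.modByMonicHom_mk, ← CycRing.degree_eq hp]
    exact degree_modByMonic_lt _ hm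
  · exact (eval_eq _).trans (AdjoinRoot.mk_leftInverse hm a)
  · change AdjoinRoot.modByMonicHom hm (eval₂ (Int.castRingHom (CycRing p k)) _ f) = f
    rw [eval_eq, AdjoinRoot.modByMonicHom_mk, modByMonic_eq_self_iff hm, CycRing.degree_eq hp]
    exact hf

theorem HasRank.mono {S : Type} [CommRing S] {s r r' : ℕ} (h : HasRank S s r) (hr : r ≤ r') :
    HasRank S s r' := by
  obtain ⟨ι, i, φ, ψ, γ, hc, h⟩ := h
  exact ⟨ι, i, φ, ψ, γ, hc.trans hr, h⟩

theorem IsCoeffMap.eq_sum {S : Type} [CommRing S] {d : ℕ} {ζ : S} {rep : S →+ ℤ[X]}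
    (h : IsCoeffMap d ζ rep) (a : S) : a = ∑ i : Fin d, ((rep a).coeff i : S) * ζ ^ (i : ℕ) := by
  conv_lhs => rw [← h.aeval_rep a]
  rw [Fin.sum_univ_eq_sum_range (fun i => ((rep a).coeff i : S) * ζ ^ i)]
  by_cases h0 : rep a = 0
  · simp [h0]
  · rw [aeval_eq_sum_range' ((natDegree_lt_iff_degree_lt h0).2 (h.degree_lt a))]
    simp

/-- The schoolbook algorithm. -/
theorem IsCoeffMap.hasRank {S : Type} [CommRing S] {d : ℕ} {ζ : S} {rep : S →+ ℤ[X]}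
    (h : IsCoeffMap d ζ rep) : HasRank S 1 (d ^ 2) := by
  let c : Fin d → S →+ ℤ := fun i => (lcoeff ℤ i).toAddMonoidHom.comp rep
  have hc : ∀ a, a = ∑ i : Fin d, (c i a : S) * ζ ^ (i : ℕ) := h.eq_sum
  refine ⟨Fin d × Fin d, inferInstance, fun x => c x.1, fun x => c x.2,
    fun x => ζ ^ (x.1 + x.2 : ℕ), ?_, fun a b => ?_⟩
  · simp only [Fintype.card_prod, Fintype.card_fin]
    exact le_of_eq (by ring)
  · conv_lhs => rw [hc a, hc b]
    rw [sum_mul_sum, Nat.cast_one, one_mul, Fintype.sum_prod_type]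
    refine sum_congr rfl fun i _ => sum_congr rfl fun j _ => ?_
    simp only [pow_add]
    push_cast
    ring

/-- `HasRank.step` with a = p^α and b = p^β. The power ξ^(p^(k' - β)) has order p^(β + 1), as ω
must; `hα` leaves room for a product of two blocks. -/
theorem CycRing.hasRank_step {p : ℕ} (hp : p.Prime) {α β k' s r : ℕ} (hβ : β ≤ k')
    (hα : 2 * p ^ α ≤ (p - 1) * p ^ k' + 1) (h : HasRank (CycRing p k') s r) :
    HasRank (CycRing p (α + β)) (s * (p * p ^ β)) (p ^ β * (p - 1) * r) := by
  have := CycRing.isDomain hp k'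
  have := CycRing.isDomain hp (α + β)
  have hζ := CycRing.isPrimitiveRoot hp (α + β)
  have hξ := CycRing.isPrimitiveRoot hp k'
  refine HasRank.step (a := p ^ α) hp.two_le (pow_pos hp.pos β) (CycRing.isCoeffMap hp (α + β))
    (by rw [pow_add]; ring) ?_ ?_ (CycRing.isCoeffMap hp k') hα
    (ω := AdjoinRoot.root _ ^ p ^ (k' - β)) ?_ h
  · rw [hζ.pow_eq_one_iff_dvd]
    exact dvd_of_eq (by rw [pow_succ, pow_add]; ring)
  · rw [pow_mul]
    refine IsPrimitiveRoot.geom_sum_eq_zero (k := p) ?_ hp.one_lt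
    refine IsPrimitiveRoot.pow_of_coprime ?_ _ ?_
    · exact hζ.pow (pow_pos hp.pos _) (by rw [pow_succ, pow_add])
    · have hpos : 0 < p * p ^ β := Nat.mul_pos hp.pos (pow_pos hp.pos β)
      refine (Nat.Prime.coprime_iff_not_dvd hp).2 (fun hd => ?_) |>.symm
      have h1 : p ∣ p * p ^ β - (p * p ^ β - 1) := Nat.dvd_sub (dvd_mul_right _ _) hd
      rw [Nat.sub_sub_self hpos] at h1
      exact hp.one_lt.ne' (Nat.dvd_one.1 h1)
  · refine hξ.pow (pow_pos hp.pos _) ?_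
    rw [← pow_succ', ← pow_add]
    congr 1
    omega

/-- The exponent drops from k to k/2 + 1, while the rank divided by 2^k at most doubles. The shift
in k - 2 is the fixed point of this map, so the bound reproduces itself exactly: 2 (k/2 + 1 - 2) ≤ k
- 2. -/
theorem CycRing.hasRank_two (k : ℕ) (hk : 3 ≤ k) :
    ∃ e, HasRank (CycRing 2 k) (2 ^ e) (8 * 2 ^ k * (k - 2)) := by
  induction k using Nat.strong_induction_on with
  | _ k ih =>
    rcases hk.eq_or_lt with rfl | hk
    -- Schoolbook multiplication in degree 8: 64 = 8 · 2^3 · 1.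
    · exact ⟨0, (CycRing.isCoeffMap Nat.prime_two 3).hasRank⟩
    · obtain ⟨e, he⟩ := ih (k / 2 + 1) (by omega) (by omega)
      have h := CycRing.hasRank_step Nat.prime_two (α := k / 2) (β := k - k / 2) (by omega)
        (by rw [pow_succ]; omega) he
      rw [show k / 2 + (k - k / 2) = k by omega, ← pow_succ', ← pow_add] at h
      refine ⟨_, h.mono ?_⟩
      calc 2 ^ (k - k / 2) * (2 - 1) * (8 * 2 ^ (k / 2 + 1) * (k / 2 + 1 - 2))
          = 8 * 2 ^ (k - k / 2 + k / 2) * (2 * (k / 2 + 1 - 2)) := by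
            rw [pow_add, pow_succ]
            ring
        _ ≤ 8 * 2 ^ k * (k - 2) := by
            rw [Nat.sub_add_cancel (Nat.div_le_self k 2)]
            exact Nat.mul_le_mul_left _ (by omega)

/-- The exponent drops from k to ⌈k/2⌉, and the doubling now comes from p - 1 = 2. The base k = 2 is
schoolbook multiplication in degree 18: 18^2 = 36 · 3^2. -/
theorem CycRing.hasRank_three (k : ℕ) (hk : 2 ≤ k) :
    ∃ e, HasRank (CycRing 3 k) (3 ^ e) (36 * 3 ^ k * (k - 1)) := by
  induction k using Nat.strong_induction_on with
  | _ k ih =>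
    rcases hk.eq_or_lt with rfl | hk
    · exact ⟨0, (CycRing.isCoeffMap Nat.prime_three 2).hasRank⟩
    · obtain ⟨e, he⟩ := ih (k - k / 2) (by omega) (by omega)
      have h := CycRing.hasRank_step Nat.prime_three (α := k - k / 2) (β := k / 2) (by omega)
        (by omega) he
      rw [show k - k / 2 + k / 2 = k by omega, ← pow_succ', ← pow_add] at h
      refine ⟨_, h.mono ?_⟩
      calc 3 ^ (k / 2) * (3 - 1) * (36 * 3 ^ (k - k / 2) * (k - k / 2 - 1))
          = 36 * 3 ^ (k - k / 2 + k / 2) * (2 * (k - k / 2 - 1)) := by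
            rw [pow_add]
            ring
        _ ≤ 36 * 3 ^ k * (k - 1) := by
            rw [Nat.sub_add_cancel (Nat.div_le_self k 2)]
            exact Nat.mul_le_mul_left _ (by omega)

/-! ### Integer bilinear algorithms for the multiplication of polynomials -/

/-- The multiplication of polynomials of degree less than `n`, scaled by `s`, is computed by a
bilinear algorithm over `ℤ` with at most `r` multiplications. -/
def PolyRank (s : ℤ) (n r : ℕ) : Prop :=
  ∃ (ι : Type) (_ : Fintype ι) (u v g : ι → ℕ → ℤ), Fintype.card ι ≤ r ∧
    ∀ i < n, ∀ j < n, ∀ l, ∑ t, u t i * v t j * g t l = if i + j = l then s else 0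

/-- For i, j < n the product ζ^i ζ^j has exponent below d, so it does not wrap around and its
coefficients are those of the polynomial product. -/
theorem HasRank.polyRank {S : Type} [CommRing S] {d : ℕ} {ζ : S} {rep : S →+ ℤ[X]}
    (h : IsCoeffMap d ζ rep) {s r n : ℕ} (hr : HasRank S s r) (hn : 2 * n ≤ d + 1) :
    PolyRank s n r := by
  obtain ⟨ι, _, φ, ψ, γ, hcard, hφ⟩ := hr
  refine ⟨ι, inferInstance, fun t i => φ t (ζ ^ i), fun t i => ψ t (ζ ^ i),
    fun t l => (rep (γ t)).coeff l, hcard, fun i hi j hj l => ?_⟩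
  have h1 := congrArg (fun a => (rep a).coeff l) (hφ (ζ ^ i) (ζ ^ j))
  have h2 : rep (ζ ^ (i + j)) = X ^ (i + j) := by
    have := h.rep_aeval (X ^ (i + j)) (by
      rw [degree_X_pow]
      have : i + j < d := by omega
      exact_mod_cast this)
    simpa using this
  have h3 : ∀ (z : ℤ) (a : S), (rep ((z : S) * a)).coeff l = z * (rep a).coeff l := by
    intro z a
    rw [← zsmul_eq_mul, map_zsmul]
    simp
  have h4 := h3 s (ζ ^ (i + j))
  rw [Int.cast_natCast] at h4
  simp only [← pow_add, map_sum, finsetSum_coeff, h3] at h1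
  rw [h4, h2, coeff_X_pow] at h1
  rw [← h1]
  simp [eq_comm]

/-- The Bézout coefficients are absorbed into the integer output forms, so the scaling disappears
without being inverted. This matters in characteristic 2 and 3. -/
theorem PolyRank.combine {s t : ℤ} {n r r' : ℕ} (hs : PolyRank s n r) (ht : PolyRank t n r')
    (hst : IsCoprime s t) : PolyRank 1 n (r + r') := by
  obtain ⟨ι, _, u, v, g, hc, h⟩ := hs
  obtain ⟨ι', _, u', v', g', hc', h'⟩ := ht
  obtain ⟨x, y, hxy⟩ := hst
  refine ⟨ι ⊕ ι', inferInstance, Sum.elim u u', Sum.elim v v',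
    Sum.elim (fun t l => x * g t l) (fun t l => y * g' t l), ?_, fun i hi j hj l => ?_⟩
  · rw [Fintype.card_sum]
    exact add_le_add hc hc'
  · rw [Fintype.sum_sum_type]
    simp only [Sum.elim_inl, Sum.elim_inr]
    have e1 : ∑ t, u t i * v t j * (x * g t l) = x * ∑ t, u t i * v t j * g t l := by
      rw [mul_sum]
      exact sum_congr rfl fun _ _ => by ring
    have e2 : ∑ t, u' t i * v' t j * (y * g' t l) = y * ∑ t, u' t i * v' t j * g' t l := by
      rw [mul_sum]
      exact sum_congr rfl fun _ _ => by ring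
    rw [e1, e2, h i hi j hj, h' i hi j hj]
    split_ifs
    · exact hxy
    · simp

theorem PolyRank.mono {s : ℤ} {n r r' : ℕ} (h : PolyRank s n r) (hr : r ≤ r') :
    PolyRank s n r' := by
  obtain ⟨ι, i, u, v, g, hc, h⟩ := h
  exact ⟨ι, i, u, v, g, hc.trans hr, h⟩

/-- Polynomials of degree less than `n = 2 ^ j` can be multiplied over `ℤ` with `O(n log n)`
multiplications, not counting those by integer constants. -/
theorem polyRank_two_pow (j : ℕ) : PolyRank 1 (2 ^ j) (1036 * (2 ^ j * (j + 1))) := by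
  -- A power of 3 within a constant factor of 2^j, so that both algorithms have comparable cost.
  have hexp : ∃ k, 2 ≤ k ∧ k ≤ j + 2 ∧ 2 ^ j ≤ 3 ^ k ∧ 3 ^ k ≤ 27 * 2 ^ j := by
    induction j with
    | zero => exact ⟨2, by norm_num⟩
    | succ j ih =>
      obtain ⟨k, h1, h2, h3, h4⟩ := ih
      by_cases h : 2 ^ (j + 1) ≤ 3 ^ k
      · exact ⟨k, h1, by omega, h, h4.trans (by rw [pow_succ]; omega)⟩
      · rw [pow_succ] at h
        refine ⟨k + 1, by omega, by omega, ?_, ?_⟩ <;> rw [pow_succ, pow_succ] <;> omega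
  obtain ⟨k, hk2, hkj, hk, hk'⟩ := hexp
  obtain ⟨e, he⟩ := CycRing.hasRank_two (j + 3) (by omega)
  obtain ⟨f, hf⟩ := CycRing.hasRank_three k hk2
  have h2 := he.polyRank (CycRing.isCoeffMap Nat.prime_two (j + 3)) (n := 2 ^ j)
    (by rw [pow_add]; omega)
  have h3 := hf.polyRank (CycRing.isCoeffMap Nat.prime_three k) (n := 2 ^ j) (by omega)
  have hco : IsCoprime ((2 ^ e : ℕ) : ℤ) ((3 ^ f : ℕ) : ℤ) :=
    Nat.isCoprime_iff_coprime.2 (Nat.Coprime.pow _ _ (by norm_num))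
  refine (h2.combine h3 hco).mono ?_
  -- The constant is 1036 = 64 + 36 · 27.
  have e1 : 8 * 2 ^ (j + 3) * (j + 3 - 2) = 64 * (2 ^ j * (j + 1)) := by
    rw [pow_add, show j + 3 - 2 = j + 1 by omega]
    ring
  have e2 : 36 * 3 ^ k * (k - 1) ≤ 36 * (27 * 2 ^ j) * (j + 1) :=
    Nat.mul_le_mul (Nat.mul_le_mul_left _ hk') (by omega)
  rw [e1]
  calc _ ≤ 64 * (2 ^ j * (j + 1)) + 36 * (27 * 2 ^ j) * (j + 1) := Nat.add_le_add_left e2 _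
    _ = _ := by ring

/-! ### Computations modulo integer linear combinations -/

section Computes

variable {R A : Type*} [CommRing R] [CommRing A] [Algebra R A]

variable (R) in
/-- `Gen R H r H'`: the subgroup `H'` arises from `H` by adjoining, `r` times, a multiple `c • v`
of an element `v` of the current subgroup by a constant `c`. -/
inductive Gen (H : AddSubgroup A) : ℕ → AddSubgroup A → Prop
  | refl : Gen H 0 H
  | step {r : ℕ} {H' : AddSubgroup A} (c : R) (v : A) : Gen H r H' → v ∈ H' →
      Gen H (r + 1) (H' ⊔ AddSubgroup.zmultiples (c • v))

theorem Gen.le {H H' : AddSubgroup A} {r : ℕ} (h : Gen R H r H') : H ≤ H' := by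
  induction h with
  | refl => exact le_rfl
  | step c v _ _ ih => exact ih.trans le_sup_left

theorem Gen.trans {H H₁ H₂ : AddSubgroup A} {r s : ℕ} (h₁ : Gen R H r H₁)
    (h₂ : Gen R H₁ s H₂) : Gen R H (r + s) H₂ := by
  induction h₂ with
  | refl => exact h₁
  | step c v _ hv ih => exact ih.step c v hv

theorem Gen.sup {H H' : AddSubgroup A} {r : ℕ} (h : Gen R H r H') (K : AddSubgroup A) :
    Gen R (H ⊔ K) r (H' ⊔ K) := by
  induction h with
  | refl => exact .refl
  | @step r H' c v _ hv ih =>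
    have := ih.step c v (le_sup_left (b := K) hv)
    rwa [sup_right_comm] at this

variable (R) in
/-- All elements of `T` can be computed from `H` with at most `r` multiplications by constants and
any number of additions and subtractions. -/
def Computes (H : AddSubgroup A) (r : ℕ) (T : AddSubgroup A) : Prop :=
  ∃ s ≤ r, ∃ H', Gen R H s H' ∧ T ≤ H'

theorem Computes.mono {H T T' : AddSubgroup A} {r r' : ℕ} (h : Computes R H r T) (hr : r ≤ r')
    (hT : T' ≤ T) : Computes R H r' T' := by
  obtain ⟨s, hs, H', hg, hle⟩ := h
  exact ⟨s, hs.trans hr, H', hg, hT.trans hle⟩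

theorem Computes.of_le {H T : AddSubgroup A} (h : T ≤ H) (r : ℕ) : Computes R H r T :=
  ⟨0, Nat.zero_le r, H, .refl, h⟩

theorem Computes.trans {H T U : AddSubgroup A} {r s : ℕ} (h₁ : Computes R H r T)
    (h₂ : Computes R T s U) : Computes R H (r + s) U := by
  obtain ⟨r', hr, H₁, hg₁, hT⟩ := h₁
  obtain ⟨s', hs, H₂, hg₂, hU⟩ := h₂
  have := hg₂.sup H₁
  rw [sup_eq_right.2 hT] at this
  exact ⟨r' + s', add_le_add hr hs, _, hg₁.trans this, hU.trans le_sup_left⟩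

theorem Computes.of_le_left {H K T : AddSubgroup A} {r : ℕ} (h : Computes R H r T)
    (hK : H ≤ K) : Computes R K r T := by
  have := (Computes.of_le hK 0).trans h
  rwa [zero_add] at this

theorem Computes.sup {H T U : AddSubgroup A} {r s : ℕ} (h₁ : Computes R H r T)
    (h₂ : Computes R H s U) : Computes R H (r + s) (T ⊔ U) := by
  obtain ⟨r', hr, H₁, hg₁, hT⟩ := h₁
  obtain ⟨s', hs, H₂, hg₂, hU⟩ := h₂
  have := hg₂.sup H₁
  rw [sup_eq_right.2 hg₁.le] at this
  exact ⟨r' + s', add_le_add hr hs, _, hg₁.trans this,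
    sup_le (hT.trans le_sup_right) (hU.trans le_sup_left)⟩

theorem Computes.biUnion {ι : Type*} {H : AddSubgroup A} (s : Finset ι) (r : ι → ℕ)
    (T : ι → Set A) (h : ∀ i ∈ s, Computes R H (r i) (AddSubgroup.closure (T i))) :
    Computes R H (∑ i ∈ s, r i) (AddSubgroup.closure (⋃ i ∈ s, T i)) := by
  classical
  induction s using Finset.induction_on with
  | empty => exact Computes.of_le (by simp) _
  | insert i s hi ih =>
    rw [sum_insert hi, Finset.set_biUnion_insert, AddSubgroup.closure_union]
    exact (h i (mem_insert_self i s)).sup (ih fun j hj => h j (mem_insert_of_mem hj))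

theorem Computes.smul {H : AddSubgroup A} {v : A} (c : R) (hv : v ∈ H) :
    Computes R H 1 (AddSubgroup.closure {c • v}) :=
  ⟨1, le_rfl, _, Gen.refl.step c v hv, by
    rw [← AddSubgroup.zmultiples_eq_closure]; exact le_sup_right⟩

theorem Computes.smul_range {ι : Type*} [Fintype ι] {H : AddSubgroup A} (c : ι → R) (v : ι → A)
    (hv : ∀ t, v t ∈ H) :
    Computes R H (Fintype.card ι) (AddSubgroup.closure (Set.range fun t => c t • v t)) := by
  have := Computes.biUnion (R := R) (H := H) univ (fun _ => 1) (fun t : ι => {c t • v t})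
    fun t _ => Computes.smul (c t) (hv t)
  refine this.mono (by simp) (AddSubgroup.closure_mono ?_)
  rintro _ ⟨t, rfl⟩
  simp

/-- The subgroup generated by the coefficients of a polynomial. -/
def coeffGroup (P : A[X]) : AddSubgroup A := AddSubgroup.closure (Set.range P.coeff)

theorem coeff_mem_coeffGroup (P : A[X]) (i : ℕ) : P.coeff i ∈ coeffGroup P :=
  AddSubgroup.subset_closure ⟨i, rfl⟩

theorem coeffGroup_le {P : A[X]} {H : AddSubgroup A} (h : ∀ i, P.coeff i ∈ H) :
    coeffGroup P ≤ H := by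
  rw [coeffGroup, AddSubgroup.closure_le]
  rintro _ ⟨i, rfl⟩
  exact h i

theorem eq_sum_of_degree_lt {B : Type*} [CommRing B] {P : B[X]} {n : ℕ} (h : P.degree < n) :
    P = ∑ i ∈ range n, monomial i (P.coeff i) := by
  ext l
  simp only [finsetSum_coeff, coeff_monomial, sum_ite_eq', mem_range]
  split_ifs with hl
  · rfl
  · exact coeff_eq_zero_of_degree_lt (h.trans_le (by exact_mod_cast not_lt.1 hl))

/-- Multiplication of a polynomial by a polynomial with known coefficients. -/
theorem PolyRank.computes_mul {n r : ℕ} (h : PolyRank 1 n r) {D : R[X]} {P : A[X]}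
    (hD : D.degree < n) (hP : P.degree < n) :
    Computes R (coeffGroup P) r (coeffGroup (D.map (algebraMap R A) * P)) := by
  obtain ⟨ι, _, u, v, g, hcard, h⟩ := h
  -- The forms in the coefficients of D are constants and those in the coefficients of P are integer
  -- combinations, so each bilinear product is one multiplication by a constant.
  have h1 := Computes.smul_range (R := R) (H := coeffGroup P)
    (fun t : ι => ∑ i ∈ range n, (u t i : R) * D.coeff i)
    (fun t => ∑ j ∈ range n, v t j • P.coeff j)
    fun t => sum_mem fun j _ => AddSubgroup.zsmul_mem _ (coeff_mem_coeffGroup P j) _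
  refine h1.mono hcard (coeffGroup_le fun l => ?_)
  have h2 : (D.map (algebraMap R A) * P).coeff l = ∑ t, g t l •
      ((∑ i ∈ range n, (u t i : R) * D.coeff i) • ∑ j ∈ range n, v t j • P.coeff j) := by
    conv_lhs => rw [eq_sum_of_degree_lt hD, eq_sum_of_degree_lt hP]
    rw [Polynomial.map_sum, sum_mul_sum, finsetSum_coeff]
    have h3 : ∀ t, g t l • ((∑ i ∈ range n, (u t i : R) * D.coeff i) •
        ∑ j ∈ range n, v t j • P.coeff j) = ∑ i ∈ range n, ∑ j ∈ range n,
          ((u t i * v t j * g t l : ℤ) : A) * (algebraMap R A (D.coeff i) * P.coeff j) := by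
      intro t
      rw [Algebra.smul_def (_ : R), map_sum, sum_mul_sum, smul_sum]
      refine sum_congr rfl fun i _ => ?_
      rw [smul_sum]
      refine sum_congr rfl fun j _ => ?_
      rw [map_mul, zsmul_eq_mul, zsmul_eq_mul, map_intCast]
      push_cast
      ring
    rw [sum_congr rfl fun t _ => h3 t, sum_comm]
    refine sum_congr rfl fun i hi => ?_
    rw [sum_comm, finsetSum_coeff]
    refine sum_congr rfl fun j hj => ?_
    rw [← sum_mul, ← Int.cast_sum, h i (mem_range.1 hi) j (mem_range.1 hj), map_monomial,
      monomial_mul_monomial, coeff_monomial]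
    split_ifs <;> simp
  rw [h2]
  refine sum_mem fun t _ => AddSubgroup.zsmul_mem _ (AddSubgroup.subset_closure ?_) _
  exact ⟨t, rfl⟩

/-! ### Fast summation of fractions -/

/-- The number of multiplications sufficient to multiply polynomials of degree less than `2 ^ j`. -/
def mulCost (j : ℕ) : ℕ := 1036 * (2 ^ j * (j + 1))

/-- The cost of a product tree or a remainder tree with `2 ^ L` leaves. -/
def treeCost (L : ℕ) : ℕ := 2072 * (2 ^ L * ((L + 1) * L))

theorem treeCost_succ (L : ℕ) :
    2 * treeCost L + 2 * mulCost (L + 1) ≤ treeCost (L + 1) := by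
  unfold treeCost mulCost
  rw [pow_succ]
  have : 0 ≤ 2 ^ L * L := Nat.zero_le _
  nlinarith

theorem degree_mul_lt {B : Type*} [CommRing B] {P Q : B[X]} {a b : ℕ} (hP : P.natDegree ≤ a)
    (hQ : Q.degree < b) : (P * Q).degree < (a + b : ℕ) := by
  by_cases h0 : Q = 0
  · rw [h0, mul_zero, degree_zero]
    exact WithBot.bot_lt_coe _
  · rw [← natDegree_lt_iff_degree_lt h0] at hQ
    refine (degree_le_natDegree).trans_lt ?_
    have : (P * Q).natDegree < a + b := natDegree_mul_le.trans_lt (by omega)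
    exact_mod_cast this

theorem natDegree_prod_range_le {d : ℕ → R[X]} (hd : ∀ r, (d r).natDegree ≤ 1) (n : ℕ) :
    (∏ r ∈ range n, d r).natDegree ≤ n := by
  refine (natDegree_prod_le _ _).trans ((sum_le_card_nsmul _ _ 1 fun r _ => hd r).trans ?_)
  simp

/-- The numerator of the sum of the fractions `u r / d r`. -/
theorem exists_numerator (L : ℕ) (d : ℕ → R[X]) (u : ℕ → A) (hd : ∀ r, (d r).natDegree ≤ 1) :
    ∃ N : A[X], N.degree < (2 ^ L : ℕ) ∧
      Computes R (AddSubgroup.closure (Set.range u)) (treeCost L) (coeffGroup N) ∧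
      ∀ (y : R) (e : ℕ → R), (∀ r, (d r).eval y * e r = 1) →
        N.eval (algebraMap R A y)
          = (∏ r ∈ range (2 ^ L), (d r).eval y) • ∑ r ∈ range (2 ^ L), e r • u r := by
  induction L generalizing d u with
  | zero =>
    refine ⟨C (u 0), ?_, Computes.of_le (coeffGroup_le fun i => ?_) _, fun y e he => ?_⟩
    · exact degree_C_le.trans_lt (by norm_num)
    · rw [coeff_C]
      split_ifs
      · exact AddSubgroup.subset_closure ⟨0, rfl⟩
      · exact zero_mem _
    · simp [smul_smul, he 0]
  | succ L ih =>
    obtain ⟨N₁, hN₁, hc₁, he₁⟩ := ih d u hd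
    obtain ⟨N₂, hN₂, hc₂, he₂⟩ := ih (fun r => d (2 ^ L + r)) (fun r => u (2 ^ L + r))
      fun r => hd _
    have hD₁ := natDegree_prod_range_le hd (2 ^ L)
    have hD₂ := natDegree_prod_range_le (fun r => hd (2 ^ L + r)) (2 ^ L)
    set D₁ := ∏ r ∈ range (2 ^ L), d r with hD₁def
    set D₂ := ∏ r ∈ range (2 ^ L), d (2 ^ L + r) with hD₂def
    have hpow : 2 ^ (L + 1) = 2 ^ L + 2 ^ L := by rw [pow_succ]; ring
    have hpos : 0 < 2 ^ L := by positivity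
    -- A product of 2^L linear factors may have degree exactly 2^L, which forces multiplication at
    -- size 2^(L + 1).
    have hlt : ∀ {D : R[X]}, D.natDegree ≤ 2 ^ L → D.degree < (2 ^ (L + 1) : ℕ) := by
      intro D hD
      refine degree_le_natDegree.trans_lt ?_
      have : D.natDegree < 2 ^ (L + 1) := by omega
      exact_mod_cast this
    have hlt' : ∀ {N : A[X]}, N.degree < (2 ^ L : ℕ) → N.degree < (2 ^ (L + 1) : ℕ) := by
      intro N hN
      refine hN.trans ?_
      have : 2 ^ L < 2 ^ (L + 1) := by omega
      exact_mod_cast this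
    -- Addition of fractions: N₁/D₁ + N₂/D₂ = (D₂ N₁ + D₁ N₂)/(D₁ D₂).
    refine ⟨D₂.map (algebraMap R A) * N₁ + D₁.map (algebraMap R A) * N₂, ?_, ?_, ?_⟩
    · rw [hpow]
      exact (degree_add_le _ _).trans_lt (max_lt
        (degree_mul_lt ((natDegree_map_le).trans hD₂) hN₁)
        (degree_mul_lt ((natDegree_map_le).trans hD₁) hN₂))
    · have m₁ := hc₁.trans
        ((polyRank_two_pow (L + 1)).computes_mul (hlt hD₂) (hlt' hN₁))
      have m₂ := (hc₂.trans
        ((polyRank_two_pow (L + 1)).computes_mul (hlt hD₁) (hlt' hN₂))).of_le_left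
          (K := AddSubgroup.closure (Set.range u)) (AddSubgroup.closure_mono (by
            rintro _ ⟨r, rfl⟩
            exact ⟨_, rfl⟩))
      refine (m₁.sup m₂).mono ?_ (coeffGroup_le fun i => ?_)
      · refine le_trans (le_of_eq ?_) (treeCost_succ L)
        unfold mulCost
        ring
      · rw [coeff_add]
        exact add_mem (AddSubgroup.mem_sup_left (coeff_mem_coeffGroup _ i))
          (AddSubgroup.mem_sup_right (coeff_mem_coeffGroup _ i))
    · intro y e he
      rw [eval_add, eval_mul, eval_mul, he₁ y e he, he₂ y (fun r => e (2 ^ L + r)) fun r => he _,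
        eval_map_algebraMap, eval_map_algebraMap, aeval_algebraMap_apply, aeval_algebraMap_apply,
        hpow, prod_range_add, sum_range_add, hD₁def, hD₂def]
      simp only [coe_aeval_eq_eval, eval_prod, Algebra.smul_def, map_mul]
      ring

/-! ### Multipoint evaluation by a scaled remainder tree. -/

/-- The coefficients of `X ^ h, …, X ^ (2 * h - 1)`, as a polynomial of degree less than `h`. -/
noncomputable def midPart (h : ℕ) (P : A[X]) : A[X] :=
  ∑ i ∈ range h, monomial i (P.coeff (i + h))

theorem coeff_midPart (h : ℕ) (P : A[X]) (i : ℕ) :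
    (midPart h P).coeff i = if i < h then P.coeff (i + h) else 0 := by
  simp [midPart, coeff_monomial]

theorem degree_midPart_lt (h : ℕ) (P : A[X]) : (midPart h P).degree < h := by
  rw [degree_lt_iff_coeff_zero]
  intro i hi
  rw [coeff_midPart, if_neg (by omega)]

theorem coeffGroup_midPart_le (h : ℕ) (P : A[X]) : coeffGroup (midPart h P) ≤ coeffGroup P := by
  refine coeffGroup_le fun i => ?_
  rw [coeff_midPart]
  split_ifs
  · exact coeff_mem_coeffGroup P _
  · exact zero_mem _

theorem exists_eq_midPart (h : ℕ) (P : A[X]) :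
    ∃ Z τ : A[X], P = X ^ (h + h) * Z + X ^ h * midPart h P + τ ∧ τ.degree < h := by
  have hc : ∀ (m : ℕ) (i : ℕ), (divX^[m] P).coeff i = P.coeff (i + m) := by
    intro m
    induction m with
    | zero => simp
    | succ m ih =>
      intro i
      rw [Function.iterate_succ_apply', coeff_divX, ih]
      congr 1
      ring
  refine ⟨divX^[h + h] P, P - (X ^ (h + h) * divX^[h + h] P + X ^ h * midPart h P), by ring, ?_⟩
  rw [degree_lt_iff_coeff_zero]
  intro i hi
  rw [coeff_sub, coeff_add, coeff_X_pow_mul', coeff_X_pow_mul', coeff_midPart, hc, if_pos hi]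
  by_cases h1 : h + h ≤ i
  · rw [if_pos h1, if_neg (by omega), Nat.sub_add_cancel h1]
    ring
  · rw [if_neg h1, if_pos (by omega), Nat.sub_add_cancel hi]
    ring

/-- `Q` consists of the first `h` coefficients of the fractional part of the expansion of `N / E`
in powers of `X⁻¹`. -/
def IsScaledRem (h : ℕ) (E N Q : A[X]) : Prop :=
  ∃ M ρ : A[X], X ^ h * N = (X ^ h * M + Q) * E + ρ ∧ ρ.degree < h

/-- Truncation from 2h to h fractional digits. The dropped low part τ enters the error as Eτ + ρ, of
degree below 2h. That error is divisible by X^h, and the quotient is the new error, of degree below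
h. -/
theorem isScaledRem_midPart {h : ℕ} {E N M P ρ : A[X]} (hE : E.natDegree ≤ h)
    (heq : X ^ (h + h) * N = (X ^ (h + h) * M + P) * E + ρ) (hρ : ρ.degree < (h + h : ℕ)) :
    IsScaledRem h E N (midPart h P) := by
  obtain ⟨Z, τ, hP, hτ⟩ := exists_eq_midPart h P
  have hT : (E * τ + ρ).degree < (h + h : ℕ) :=
    (degree_add_le _ _).trans_lt (max_lt (degree_mul_lt hE hτ) hρ)
  have hdvd : (X : A[X]) ^ h ∣ E * τ + ρ := by
    refine ⟨X ^ h * N - (X ^ h * (M + Z) + midPart h P) * E, ?_⟩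
    have : E * τ + ρ = X ^ (h + h) * N - (X ^ (h + h) * M + P) * E + τ * E := by
      rw [heq]; ring
    rw [this]
    conv_lhs => rw [hP]
    rw [pow_add]
    ring
  obtain ⟨σ, hσ⟩ := hdvd
  refine ⟨M + Z, σ, ?_, ?_⟩
  · have hX : IsRegular ((X : A[X]) ^ h) := (monic_X_pow h).isRegular
    apply hX.left
    simp only
    have : X ^ h * (X ^ h * N) = X ^ (h + h) * N := by rw [pow_add]; ring
    rw [this, heq, mul_add (X ^ h) _ σ, ← hσ]
    conv_lhs => rw [hP]
    rw [pow_add]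
    ring
  · rw [degree_lt_iff_coeff_zero] at hT ⊢
    intro i hi
    have := hT (i + h) (by omega)
    rwa [hσ, coeff_X_pow_mul] at this

/-- N/E = E' · N/(E E'), so descending the tree takes one multiplication by the known E' and no
division. -/
theorem IsScaledRem.child {h : ℕ} {E E' N Q : A[X]} (hE : E.natDegree ≤ h)
    (hQ : IsScaledRem (h + h) (E * E') N Q) : IsScaledRem h E N (midPart h (E' * Q)) := by
  obtain ⟨M, ρ, heq, hρ⟩ := hQ
  refine isScaledRem_midPart (M := M * E') hE ?_ hρ
  rw [heq]
  ring

/-- At a leaf, X N = (X M + q)(X - c) + r with constants q and r. Setting X = 0 gives r = qc, whence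
N = M (X - c) + q. -/
theorem IsScaledRem.eval {c : A} {N Q : A[X]} (hQ : Q.degree < (1 : ℕ))
    (h : IsScaledRem 1 (X - C c) N Q) : N.eval c = Q.coeff 0 := by
  have hconst : ∀ P : A[X], P.degree < (1 : ℕ) → P = C (P.coeff 0) := by
    intro P hP
    conv_lhs => rw [eq_sum_of_degree_lt hP]
    simp
  obtain ⟨M, ρ, heq, hρ⟩ := h
  rw [hconst Q hQ, hconst ρ hρ] at heq
  have h0 := congrArg (Polynomial.eval 0) heq
  have h1 : X * N = X * (M * (X - C c) + C (Q.coeff 0)) := by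
    have h2 : ρ.coeff 0 = Q.coeff 0 * c := by
      simp at h0
      linear_combination -h0
    rw [h2, C_mul] at heq
    linear_combination heq
  have h3 := monic_X.isRegular.left h1
  rw [h3]
  simp

/-- Evaluation at all the points `y r` by a scaled remainder tree. -/
theorem computes_eval (L : ℕ) (y : ℕ → R) (N Q : A[X]) (hQ : Q.degree < (2 ^ L : ℕ))
    (h : IsScaledRem (2 ^ L) (∏ r ∈ range (2 ^ L), (X - C (algebraMap R A (y r)))) N Q) :
    Computes R (coeffGroup Q) (treeCost L)
      (AddSubgroup.closure ((fun r => N.eval (algebraMap R A (y r))) '' Set.Iio (2 ^ L))) := by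
  induction L generalizing y Q with
  | zero =>
    refine Computes.of_le ((AddSubgroup.closure_le _).2 ?_) _
    rintro _ ⟨r, hr, rfl⟩
    rw [pow_zero, Set.mem_Iio, Nat.lt_one_iff] at hr
    subst hr
    rw [pow_zero, prod_range_one] at h
    rw [pow_zero] at hQ
    simp only
    rw [h.eval hQ]
    exact coeff_mem_coeffGroup Q 0
  | succ L ih =>
    have hpow : 2 ^ (L + 1) = 2 ^ L + 2 ^ L := by rw [pow_succ]; ring
    have hpos : 0 < 2 ^ L := by positivity
    have hE : ∀ y : ℕ → R, (∏ r ∈ range (2 ^ L), (X - C (y r))).natDegree ≤ 2 ^ L :=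
      fun y => natDegree_prod_range_le (fun r => natDegree_X_sub_C_le _) _
    have hmap : ∀ y : ℕ → R, ∏ r ∈ range (2 ^ L), (X - C (algebraMap R A (y r)))
        = (∏ r ∈ range (2 ^ L), (X - C (y r))).map (algebraMap R A) := by
      intro y
      simp [Polynomial.map_prod]
    -- Both children are instances of this one statement, with the roles of the two halves
    -- exchanged.
    have half : ∀ y y' : ℕ → R, IsScaledRem (2 ^ L + 2 ^ L)
        ((∏ r ∈ range (2 ^ L), (X - C (algebraMap R A (y r)))) *
          ∏ r ∈ range (2 ^ L), (X - C (algebraMap R A (y' r)))) N Q →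
        Computes R (coeffGroup Q) (mulCost (L + 1) + treeCost L) (AddSubgroup.closure
          ((fun r => N.eval (algebraMap R A (y r))) '' Set.Iio (2 ^ L))) := by
      intro y y' hr
      have hD : (∏ r ∈ range (2 ^ L), (X - C (y' r))).degree
          < ((2 ^ (L + 1) : ℕ) : WithBot ℕ) := by
        refine degree_le_natDegree.trans_lt ?_
        have : (∏ r ∈ range (2 ^ L), (X - C (y' r))).natDegree < 2 ^ (L + 1) := by
          have := hE y'
          omega
        exact_mod_cast this
      have h1 := (polyRank_two_pow (L + 1)).computes_mul hD hQ
      rw [← hmap] at h1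
      have h2 := ih y _ (degree_midPart_lt _ _) (hr.child
        (by rw [hmap]; exact natDegree_map_le.trans (hE y)))
      exact h1.trans (h2.of_le_left (coeffGroup_midPart_le _ _))
    rw [hpow, prod_range_add] at h
    have h₁ := half y (fun r => y (2 ^ L + r)) h
    have h₂ := half (fun r => y (2 ^ L + r)) y (by rwa [mul_comm])
    refine (h₁.sup h₂).mono ((le_of_eq (by ring)).trans (treeCost_succ L)) ?_
    rw [← AddSubgroup.closure_union]
    refine AddSubgroup.closure_mono ?_
    rintro _ ⟨r, hr, rfl⟩
    rw [hpow, Set.mem_Iio] at hr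
    by_cases hr' : r < 2 ^ L
    · exact Or.inl ⟨r, hr', rfl⟩
    · refine Or.inr ⟨r - 2 ^ L, by rw [Set.mem_Iio]; omega, ?_⟩
      simp only
      rw [Nat.add_sub_cancel' (not_lt.1 hr')]

/-- The root of the tree. The quotient V of X^(2^(L+1)) by E is a truncated expansion of 1/E and
depends only on the evaluation points. Hence N/E costs one multiplication by known coefficients, and
it has no polynomial part because deg N < deg E. -/
theorem exists_isScaledRem [Nontrivial A] (L : ℕ) {E : R[X]} (hE : E.Monic)
    (hdeg : E.natDegree = 2 ^ L) {N : A[X]} (hN : N.degree < (2 ^ L : ℕ)) :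
    ∃ Q : A[X], Q.degree < (2 ^ L : ℕ) ∧ IsScaledRem (2 ^ L) (E.map (algebraMap R A)) N Q ∧
      Computes R (coeffGroup N) (mulCost (L + 1)) (coeffGroup Q) := by
  have : Nontrivial R := (algebraMap R A).domain_nontrivial
  have hpow : 2 ^ (L + 1) = 2 ^ L + 2 ^ L := by rw [pow_succ]; ring
  have hpos : 0 < 2 ^ L := by positivity
  set V : R[X] := X ^ (2 ^ L + 2 ^ L) /ₘ E with hV
  set σ : R[X] := X ^ (2 ^ L + 2 ^ L) %ₘ E with hσ
  have heq : X ^ (2 ^ L + 2 ^ L) = V * E + σ := by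
    rw [hV, hσ]
    linear_combination -modByMonic_add_div (X ^ (2 ^ L + 2 ^ L)) E
  have hVdeg : V.degree < (2 ^ (L + 1) : ℕ) := by
    refine degree_le_natDegree.trans_lt ?_
    have : V.natDegree < 2 ^ (L + 1) := by
      rw [hV, natDegree_divByMonic _ hE, natDegree_X_pow, hdeg]
      omega
    exact_mod_cast this
  have hσdeg : (σ.map (algebraMap R A)).degree < (2 ^ L : ℕ) := by
    refine degree_map_le.trans_lt ?_
    have := degree_modByMonic_lt (X ^ (2 ^ L + 2 ^ L)) hE
    rwa [degree_eq_natDegree hE.ne_zero, hdeg] at this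
  refine ⟨midPart (2 ^ L) (V.map (algebraMap R A) * N), degree_midPart_lt _ _,
    isScaledRem_midPart (M := 0) (ρ := N * σ.map (algebraMap R A))
      (natDegree_map_le.trans hdeg.le) ?_ ?_, ?_⟩
  · have := congrArg (Polynomial.map (algebraMap R A)) heq
    rw [Polynomial.map_pow, map_X, Polynomial.map_add, Polynomial.map_mul] at this
    rw [this]
    ring
  · refine degree_mul_lt ?_ hσdeg
    by_cases h0 : N = 0
    · simp [h0]
    · exact ((natDegree_lt_iff_degree_lt h0).2 hN).le
  · refine ((polyRank_two_pow (L + 1)).computes_mul hVdeg (hN.trans ?_)).mono le_rfl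
      (coeffGroup_midPart_le _ _)
    have : 2 ^ L < 2 ^ (L + 1) := by omega
    exact_mod_cast this

/-! ### Multiplication by a Cauchy matrix. -/

/-- The cost of multiplying a vector by a Cauchy matrix with at most `n` rows and `n` columns. -/
def cauchyCost (n : ℕ) : ℕ := 14505 * (2 ^ Nat.clog 2 n * Nat.clog 2 n ^ 2)

theorem treeCost_le_cauchyCost {n : ℕ} (hn : 2 ≤ n) :
    treeCost (Nat.clog 2 n) + (mulCost (Nat.clog 2 n + 1) + treeCost (Nat.clog 2 n)) + n
      ≤ cauchyCost n := by
  have hL : 1 ≤ Nat.clog 2 n := Nat.clog_pos (by norm_num) hn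
  have hle : n ≤ 2 ^ Nat.clog 2 n := Nat.le_pow_clog (by norm_num) n
  unfold treeCost mulCost cauchyCost
  generalize Nat.clog 2 n = L at *
  -- The constant is 14505 = 2 · 2072 · 2 + 2072 · 3 + 1: two trees, the product at the root, and
  -- the n final multiplications.
  have h1 : (L + 1) * L ≤ 2 * L ^ 2 := by nlinarith
  have h2 : L + 1 + 1 ≤ 3 * L ^ 2 := by nlinarith
  have h3 : 1 ≤ L ^ 2 := Nat.one_le_pow _ _ hL
  have h4 := Nat.mul_le_mul_left (2 ^ L) h1
  have h5 := Nat.mul_le_mul_left (2 ^ L) h2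
  have h6 := Nat.mul_le_mul_left (2 ^ L) h3
  rw [pow_succ]
  nlinarith

theorem computes_cauchy {k n : ℕ} (hkn : k ≤ n) (hn : 2 ≤ n) (x : Fin k → R) (y : Fin n → R)
    (e : Fin k → Fin n → R) (he : ∀ r c, (x r - y c) * e r c = 1) (u : Fin k → A) :
    Computes R (AddSubgroup.closure (Set.range u)) (cauchyCost n)
      (AddSubgroup.closure (Set.range fun c => ∑ r, e r c • u r)) := by
  rcases subsingleton_or_nontrivial A with hA | hA
  · exact Computes.of_le (fun a _ => by rw [Subsingleton.elim a 0]; exact zero_mem _) _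
  have : Nontrivial R := (algebraMap R A).domain_nontrivial
  set L := Nat.clog 2 n with hL
  have hle : n ≤ 2 ^ L := Nat.le_pow_clog (by norm_num) n
  -- pad with zero messages and with evaluation points `0`
  let d' : ℕ → R[X] := fun r => if h : r < k then C (x ⟨r, h⟩) - X else 1
  let u' : ℕ → A := fun r => if h : r < k then u ⟨r, h⟩ else 0
  let y' : ℕ → R := fun c => if h : c < n then y ⟨c, h⟩ else 0
  let e' : Fin n → ℕ → R := fun c r => if h : r < k then e ⟨r, h⟩ c else 1
  have hd' : ∀ r, (d' r).natDegree ≤ 1 := by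
    intro r
    simp only [d']
    split_ifs
    · rw [natDegree_sub]
      exact natDegree_X_sub_C_le _
    · simp
  have he' : ∀ c r, (d' r).eval (y c) * e' c r = 1 := by
    intro c r
    simp only [d', e']
    split_ifs
    · simpa using he _ c
    · simp
  obtain ⟨N, hN, hNc, hNe⟩ := exists_numerator L d' u' hd'
  have hEm : (∏ r ∈ range (2 ^ L), (X - C (y' r))).Monic :=
    monic_prod_of_monic _ _ fun r _ => monic_X_sub_C _
  have hEd : (∏ r ∈ range (2 ^ L), (X - C (y' r))).natDegree = 2 ^ L := by
    rw [natDegree_prod_of_monic _ _ fun r _ => monic_X_sub_C _]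
    simp
  obtain ⟨Q, hQ, hQN, hQc⟩ := exists_isScaledRem L hEm hEd hN
  rw [Polynomial.map_prod] at hQN
  simp only [Polynomial.map_sub, map_X, map_C] at hQN
  have hev := computes_eval L y' N Q hQ hQN
  set T := AddSubgroup.closure
    ((fun r => N.eval (algebraMap R A (y' r))) '' Set.Iio (2 ^ L)) with hT
  -- Division of N(y_c) by the common denominator, whose inverse is a constant.
  have hfin := Computes.smul_range (R := R) (H := T)
    (fun c : Fin n => ∏ r ∈ range (2 ^ L), e' c r) (fun c => N.eval (algebraMap R A (y c)))
    fun c => AddSubgroup.subset_closure ⟨c, c.2.trans_le hle, by simp [y']⟩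
  rw [Fintype.card_fin] at hfin
  have hu : AddSubgroup.closure (Set.range u') ≤ AddSubgroup.closure (Set.range u) := by
    rw [AddSubgroup.closure_le]
    rintro _ ⟨r, rfl⟩
    simp only [u']
    split_ifs
    · exact AddSubgroup.subset_closure ⟨_, rfl⟩
    · exact zero_mem _
  refine (((hNc.trans (hQc.trans hev)).trans hfin).of_le_left hu).mono
    (treeCost_le_cauchyCost hn) (AddSubgroup.closure_mono ?_)
  rintro _ ⟨c, rfl⟩
  refine ⟨c, ?_⟩
  simp only
  rw [hNe (y c) (e' c) (he' c), smul_smul, ← prod_mul_distrib,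
    prod_congr rfl fun r _ => (mul_comm _ _).trans (he' c r), prod_const_one, one_smul]
  have hk : k ≤ 2 ^ L := hkn.trans hle
  rw [← sum_subset (range_subset_range.2 hk), ← Fin.sum_univ_eq_sum_range]
  · exact sum_congr rfl fun r _ => by simp [e', u']
  · intro r _ hr
    rw [mem_range] at hr
    simp [u', hr]

end Computes

end Algebra

section Encoding

open Finset

/-! ### Straight-line programs -/

section Programs

variable {M R : Type*}

theorem runSteps_append [Ring R] (w : ℕ → R) (m : M → R) (l₁ l₂ : List (Step M)) (v : List R) :
    runSteps w m (l₁ ++ l₂) v = runSteps w m l₂ (runSteps w m l₁ v) := by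
  induction l₁ generalizing v with
  | nil => rfl
  | cons s l ih => exact ih _

theorem length_runSteps [Ring R] (w : ℕ → R) (m : M → R) (l : List (Step M)) (v : List R) :
    (runSteps w m l v).length = v.length + l.length := by
  induction l generalizing v with
  | nil => rfl
  | cons s l ih =>
    rw [runSteps, ih, List.length_append, List.length_singleton, List.length_cons]
    omega

theorem getD_runSteps_of_lt [Ring R] (w : ℕ → R) (m : M → R) (l : List (Step M)) (v : List R)
    {i : ℕ} (hi : i < v.length) : (runSteps w m l v).getD i 0 = v.getD i 0 := by
  induction l generalizing v with
  | nil => rfl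
  | cons s l ih =>
    rw [runSteps, ih _ (by rw [List.length_append]; omega), List.getD_append _ _ _ _ hi]

theorem runSteps_congr [Ring R] {w w' : ℕ → R} (m : M → R) (l : List (Step M)) (v : List R)
    (h : ∀ j, Step.const j ∈ l → w j = w' j) : runSteps w m l v = runSteps w' m l v := by
  induction l generalizing v with
  | nil => rfl
  | cons s l ih =>
    have hs : s.value w m v = s.value w' m v := by
      cases s with
      | const j => exact h j List.mem_cons_self
      | _ => rfl
    rw [runSteps, runSteps, hs, ih _ fun j hj => h j (List.mem_cons_of_mem _ hj)]

/-- Steps use only ring operations and therefore commute with ring homomorphisms. This is what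
carries a program from a product of fields to a single factor. -/
theorem map_runSteps {S : Type*} [Ring R] [Ring S] (f : R →+* S) (w : ℕ → R) (m : M → R)
    (l : List (Step M)) (v : List R) :
    (runSteps w m l v).map f = runSteps (f ∘ w) (f ∘ m) l (v.map f) := by
  have hget : ∀ (v : List R) (i : ℕ), (v.map f).getD i 0 = f (v.getD i 0) := by
    intro v i
    rw [← map_zero f, List.getD_map]
  induction l generalizing v with
  | nil => rfl
  | cons s l ih =>
    rw [runSteps, runSteps, ih, List.map_append, List.map_singleton]
    congr 3
    cases s <;> simp only [Step.value, hget, map_add, map_sub, map_mul, Function.comp_apply]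

theorem Program.map_eval {C S : Type*} [Ring R] [Ring S] (f : R →+* S) (P : Program M C)
    (w : ℕ → R) (m : M → R) (c : C) : P.eval (f ∘ w) (f ∘ m) c = f (P.eval w m c) := by
  have h := map_runSteps f w m P.steps []
  rw [List.map_nil] at h
  rw [Program.eval, Program.eval, ← h, ← map_zero f, List.getD_map]

variable [CommRing R]

/-- The function `v` of the message is the result of one of the steps `l`. -/
def IsResult (l : List (Step M)) (w : ℕ → R) (v : (M → R) → R) : Prop :=
  ∃ i < l.length, ∀ m, (runSteps w m l []).getD i 0 = v m

theorem IsResult.append {l : List (Step M)} {w : ℕ → R} {v : (M → R) → R}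
    (h : IsResult l w v) (l' : List (Step M)) : IsResult (l ++ l') w v := by
  obtain ⟨i, hi, h⟩ := h
  refine ⟨i, by rw [List.length_append]; omega, fun m => ?_⟩
  rw [runSteps_append, getD_runSteps_of_lt, h]
  rwa [length_runSteps, List.length_nil, zero_add]

theorem isResult_append_singleton {l : List (Step M)} {w : ℕ → R} {v : (M → R) → R}
    {s : Step M} (h : ∀ m, s.value w m (runSteps w m l []) = v m) :
    IsResult (l ++ [s]) w v := by
  refine ⟨l.length, by simp, fun m => ?_⟩
  rw [runSteps_append, runSteps, runSteps, List.getD_append_right] <;>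
    simp [length_runSteps, h]

/-- The list contains neither multiplications nor constants. -/
def IsAdditive (l : List (Step M)) : Prop :=
  ∀ s ∈ l, s.isMul = false ∧ ∀ j, s ≠ .const j

theorem IsAdditive.append {l l' : List (Step M)} (h : IsAdditive l) (h' : IsAdditive l') :
    IsAdditive (l ++ l') := by
  intro s hs
  rcases List.mem_append.1 hs with hs | hs
  · exact h s hs
  · exact h' s hs

theorem isAdditive_nil : IsAdditive ([] : List (Step M)) := by
  intro s hs
  simp at hs

theorem isAdditive_singleton {s : Step M} (h : s.isMul = false) (h' : ∀ j, s ≠ .const j) :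
    IsAdditive [s] := by
  intro s' hs
  obtain rfl := List.mem_singleton.1 hs
  exact ⟨h, h'⟩

theorem exists_isResult_of_mem_closure {w : ℕ → R} {S : Set ((M → R) → R)} {v : (M → R) → R}
    (hv : v ∈ AddSubgroup.closure S) (l : List (Step M)) (hl : ∀ u ∈ S, IsResult l w u) :
    ∃ l', IsAdditive l' ∧ IsResult (l ++ l') w v := by
  induction hv using AddSubgroup.closure_induction generalizing l with
  | mem u hu => exact ⟨[], isAdditive_nil, by simpa using hl u hu⟩
  | zero =>
    refine ⟨[.sub 0 0], isAdditive_singleton rfl (by simp), isResult_append_singleton fun m => ?_⟩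
    simp [Step.value]
  | add a b _ _ iha ihb =>
    obtain ⟨l₁, h₁, ha⟩ := iha l hl
    obtain ⟨l₂, h₂, hb⟩ := ihb (l ++ l₁) fun u hu => (hl u hu).append l₁
    obtain ⟨i, _, hi⟩ := ha.append l₂
    obtain ⟨j, _, hj⟩ := hb
    refine ⟨l₁ ++ l₂ ++ [.add i j],
      (h₁.append h₂).append (isAdditive_singleton rfl (by simp)), ?_⟩
    rw [← List.append_assoc, ← List.append_assoc]
    refine isResult_append_singleton fun m => ?_
    simp only [Step.value, Pi.add_apply]
    rw [hi m, hj m]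
  | neg a _ iha =>
    obtain ⟨l₁, h₁, ha⟩ := iha l hl
    have hz : IsResult (l ++ l₁ ++ [.sub 0 0]) w (0 : (M → R) → R) :=
      isResult_append_singleton fun m => by simp [Step.value]
    obtain ⟨i, _, hi⟩ := ha.append [.sub 0 0]
    obtain ⟨j, _, hj⟩ := hz
    refine ⟨l₁ ++ [.sub 0 0] ++ [.sub j i],
      (h₁.append (isAdditive_singleton rfl (by simp))).append
        (isAdditive_singleton rfl (by simp)), ?_⟩
    rw [← List.append_assoc, ← List.append_assoc]
    refine isResult_append_singleton fun m => ?_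
    simp only [Step.value, Pi.neg_apply]
    rw [hi m, hj m]
    simp

theorem exists_isResult_of_subset_closure {w : ℕ → R} {S : Set ((M → R) → R)}
    (T : Finset ((M → R) → R)) (hT : ∀ v ∈ T, v ∈ AddSubgroup.closure S) (l : List (Step M))
    (hl : ∀ u ∈ S, IsResult l w u) :
    ∃ l', IsAdditive l' ∧ ∀ v ∈ T, IsResult (l ++ l') w v := by
  classical
  induction T using Finset.induction_on with
  | empty => exact ⟨[], isAdditive_nil, by simp⟩
  | insert v T _ ih =>
    obtain ⟨l₁, h₁, ih⟩ := ih fun u hu => hT u (mem_insert_of_mem hu)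
    obtain ⟨l₂, h₂, hv⟩ := exists_isResult_of_mem_closure (hT v (mem_insert_self v T)) (l ++ l₁)
      fun u hu => (hl u hu).append l₁
    refine ⟨l₁ ++ l₂, h₁.append h₂, fun u hu => ?_⟩
    rw [← List.append_assoc]
    rcases mem_insert.1 hu with rfl | hu
    · exact hv
    · exact (ih u hu).append l₂

theorem IsAdditive.countP_eq_zero {l : List (Step M)} (h : IsAdditive l) :
    l.countP Step.isMul = 0 := by
  rw [List.countP_eq_zero]
  intro s hs
  rw [(h s hs).1]
  simp

/-- A message symbol, as a function of the message. -/
def coord (R : Type*) {M : Type*} (i : M) : (M → R) → R := fun m => m i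

theorem exists_read_message [Finite M] (w : ℕ → R) :
    ∃ l : List (Step M), IsAdditive l ∧ ∀ i, IsResult l w (coord R i) := by
  classical
  have := Fintype.ofFinite M
  suffices h : ∀ s : Finset M, ∃ l : List (Step M), IsAdditive l ∧
      ∀ i ∈ s, IsResult l w (coord R i) by
    obtain ⟨l, hl, h⟩ := h univ
    exact ⟨l, hl, fun i => h i (mem_univ i)⟩
  intro s
  induction s using Finset.induction_on with
  | empty => exact ⟨[], isAdditive_nil, by simp⟩
  | insert i s _ ih =>
    obtain ⟨l, hl, h⟩ := ih
    refine ⟨l ++ [.msg i], hl.append (isAdditive_singleton rfl (by simp)), fun j hj => ?_⟩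
    rcases mem_insert.1 hj with rfl | hj
    · exact isResult_append_singleton fun m => rfl
    · exact (h j hj).append _

/-- By induction from the last adjoined generator. The subgroups are infinite, but only finitely
many elements are needed: each target is a + z·(c • v) with z an integer, so it suffices to have
produced v and the finitely many a, then to multiply once and finish additively. -/
theorem Gen.exists_steps [Finite M] {r : ℕ} {H : AddSubgroup ((M → R) → R)}
    (h : Gen R (AddSubgroup.closure (Set.range (coord R))) r H) (T : Finset ((M → R) → R))
    (hT : ∀ v ∈ T, v ∈ H) :
    ∃ (l : List (Step M)) (w : ℕ → R), l.countP Step.isMul = r ∧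
      (∀ j, Step.const j ∈ l → j < r) ∧ ∀ v ∈ T, IsResult l w v := by
  classical
  induction h generalizing T with
  | refl =>
    obtain ⟨l, hl, hm⟩ := exists_read_message (M := M) (0 : ℕ → R)
    obtain ⟨l', hl', h⟩ := exists_isResult_of_subset_closure T hT l (by
      rintro _ ⟨i, rfl⟩
      exact hm i)
    refine ⟨l ++ l', 0, (hl.append hl').countP_eq_zero, fun j hj => ?_, h⟩
    exact absurd rfl (((hl.append hl') _ hj).2 j)
  | @step r H' c v _ hv ih =>
    have hsplit : ∀ t : T, ∃ a ∈ H', t.1 ∈ AddSubgroup.closure {a, c • v} := by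
      intro t
      obtain ⟨a, ha, b, hb, hab⟩ := AddSubgroup.mem_sup.1 (hT t.1 t.2)
      refine ⟨a, ha, ?_⟩
      rw [← hab]
      refine add_mem (AddSubgroup.subset_closure (by simp)) ?_
      rw [AddSubgroup.zmultiples_eq_closure] at hb
      exact AddSubgroup.closure_mono (by simp) hb
    choose a haH ha using hsplit
    obtain ⟨l, w, hcount, hconst, hres⟩ := ih (insert v (univ.image a)) (by
      intro u hu
      rcases mem_insert.1 hu with rfl | hu
      · exact hv
      · obtain ⟨t, _, rfl⟩ := mem_image.1 hu
        exact haH t)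
    -- Slot r of the table is still free, since all constants read so far have index below r.
    set w' : ℕ → R := Function.update w r c with hw'
    have hres' : ∀ u ∈ insert v (univ.image a), IsResult l w' u := by
      intro u hu
      obtain ⟨i, hi, h⟩ := hres u hu
      refine ⟨i, hi, fun m => ?_⟩
      rw [← h m, runSteps_congr m l []]
      intro j hj
      rw [hw', Function.update_of_ne (hconst j hj).ne]
    have hc : IsResult (l ++ [.const r]) w' (fun _ => c) :=
      isResult_append_singleton fun m => by simp [Step.value, hw']
    obtain ⟨i, _, hi⟩ := hc
    obtain ⟨j, _, hj⟩ := (hres' v (mem_insert_self _ _)).append [.const r]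
    have hcv : IsResult (l ++ [.const r] ++ [.mul i j]) w' (c • v) :=
      isResult_append_singleton fun m => by
        simp only [Step.value, Pi.smul_apply, smul_eq_mul]
        rw [hi m, hj m]
    obtain ⟨l', hl', h⟩ := exists_isResult_of_subset_closure (w := w')
      (S := Set.range a ∪ {c • v}) T
      (fun t ht => AddSubgroup.closure_mono (by
        rintro u (rfl | rfl)
        · exact Or.inl ⟨_, rfl⟩
        · exact Or.inr rfl) (ha ⟨t, ht⟩)) (l ++ [.const r] ++ [.mul i j]) (by
        rintro u (⟨t, rfl⟩ | rfl)
        · rw [List.append_assoc]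
          exact (hres' _ (mem_insert_of_mem (mem_image_of_mem a (mem_univ t)))).append _
        · exact hcv)
    refine ⟨l ++ [.const r] ++ [.mul i j] ++ l', w', ?_, fun q hq => ?_, h⟩
    · rw [List.countP_append, List.countP_append, List.countP_append, hcount, hl'.countP_eq_zero]
      simp [Step.isMul]
    · simp only [List.append_assoc, List.mem_append, List.mem_singleton, Step.const.injEq,
        reduceCtorEq, false_or] at hq
      rcases hq with hq | rfl | hq
      · exact (hconst q hq).trans (Nat.lt_succ_self r)
      · exact Nat.lt_succ_self q
      · exact absurd rfl ((hl' _ hq).2 q)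

theorem Computes.exists_program {C : Type*} [Finite M] [Finite C] {r : ℕ}
    {v : C → (M → R) → R}
    (h : Computes R (AddSubgroup.closure (Set.range (coord R))) r
      (AddSubgroup.closure (Set.range v))) :
    ∃ (P : Program M C) (w : ℕ → R), P.mulCount ≤ r ∧ ∀ m c, P.eval w m c = v c m := by
  classical
  have := Fintype.ofFinite C
  obtain ⟨s, hs, H, hg, hle⟩ := h
  obtain ⟨l, w, hcount, _, hres⟩ := hg.exists_steps (univ.image v) (by
    intro u hu
    obtain ⟨c, _, rfl⟩ := mem_image.1 hu
    exact hle (AddSubgroup.subset_closure ⟨c, rfl⟩))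
  have hout : ∀ c, ∃ i, ∀ m, (runSteps w m l []).getD i 0 = v c m := fun c => by
    obtain ⟨i, _, hi⟩ := hres (v c) (mem_image_of_mem v (mem_univ c))
    exact ⟨i, hi⟩
  choose out hout using hout
  exact ⟨⟨l, out⟩, w, hcount.le.trans hs, fun m c => hout c m⟩

end Programs

/-! ### The encoder -/

theorem exists_encoder (R : Type*) [CommRing R] {ℓ h : ℕ} {k n : Fin ℓ → ℕ} (hk : ∀ i, h ≤ k i)
    (hkn : ∀ i, k i ≤ n i) (hn : ∀ i, 2 ≤ n i) (x : (i : Fin ℓ) → Fin (k i) → R)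
    (y : (i : Fin ℓ) → Fin (n i) → R) (e : (i : Fin ℓ) → Fin (k i) → Fin (n i) → R)
    (he : ∀ i r c, (x i r - y i c) * e i r c = 1) (α : R) :
    ∃ (P : Program (MsgIndex ℓ k) (CodeIndex ℓ h n)) (w : ℕ → R),
      P.mulCount ≤ ∑ i, cauchyCost (n i) + ℓ * h ∧ ∀ m,
        (∀ i c, P.eval w m (Sum.inl ⟨i, c⟩) = ∑ r, m ⟨i, r⟩ * e i r c) ∧
        ∀ c : Fin h, P.eval w m (Sum.inr c)
          = ∑ i : Fin ℓ, m ⟨i, Fin.castLE (hk i) c⟩ * α ^ ((c : ℕ) * i) := by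
  let v : CodeIndex ℓ h n → (MsgIndex ℓ k → R) → R := Sum.elim
    (fun a => ∑ r, e a.1 r a.2 • coord R ⟨a.1, r⟩)
    (fun c => ∑ i : Fin ℓ, α ^ ((c : ℕ) * i) • coord R ⟨i, Fin.castLE (hk i) c⟩)
  set H : AddSubgroup ((MsgIndex ℓ k → R) → R) := AddSubgroup.closure (Set.range (coord R)) with hH
  have h1 := Computes.biUnion (R := R) (H := H) univ (fun i => cauchyCost (n i))
    (fun i : Fin ℓ => Set.range fun c => ∑ r, e i r c • coord R (⟨i, r⟩ : MsgIndex ℓ k))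
    fun i _ => (computes_cauchy (hkn i) (hn i) (x i) (y i) (e i) (he i)
      fun r => coord R (⟨i, r⟩ : MsgIndex ℓ k)).of_le_left (AddSubgroup.closure_mono (by
        rintro _ ⟨r, rfl⟩
        exact ⟨_, rfl⟩))
  have h2 := Computes.smul_range (R := R) (H := H)
    (fun a : Fin ℓ × Fin h => α ^ ((a.2 : ℕ) * (a.1 : ℕ)))
    (fun a => coord R (⟨a.1, Fin.castLE (hk a.1) a.2⟩ : MsgIndex ℓ k))
    fun a => AddSubgroup.subset_closure ⟨_, rfl⟩
  rw [Fintype.card_prod, Fintype.card_fin, Fintype.card_fin] at h2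
  have hv : Computes R H (∑ i, cauchyCost (n i) + ℓ * h) (AddSubgroup.closure (Set.range v)) := by
    refine (h1.sup h2).mono le_rfl ((AddSubgroup.closure_le _).2 ?_)
    rintro _ ⟨⟨i, c⟩ | c, rfl⟩
    · refine AddSubgroup.mem_sup_left (AddSubgroup.subset_closure ?_)
      simp only [mem_univ, Set.iUnion_true, Set.mem_iUnion]
      exact ⟨i, c, rfl⟩
    · refine AddSubgroup.mem_sup_right (sum_mem fun i _ => AddSubgroup.subset_closure ?_)
      exact ⟨(i, c), rfl⟩
  obtain ⟨P, w, hP, hw⟩ := hv.exists_program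
  refine ⟨P, w, hP, fun m => ⟨fun i c => ?_, fun c => ?_⟩⟩
  · rw [hw]
    simp only [v, Sum.elim_inl, Finset.sum_apply, Pi.smul_apply, smul_eq_mul, coord]
    exact sum_congr rfl fun r _ => mul_comm _ _
  · rw [hw]
    simp only [v, Sum.elim_inr, Finset.sum_apply, Pi.smul_apply, smul_eq_mul, coord]
    exact sum_congr rfl fun r _ => mul_comm _ _

/-! ### One program for all fields. -/

/-- The field elements that determine the code. -/
structure CodeData.{u} (ℓ : ℕ) (k n : Fin ℓ → ℕ) : Type (u + 1) where
  K : Type u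
  [field : Field K]
  x : (i : Fin ℓ) → Fin (k i) → K
  y : (i : Fin ℓ) → Fin (n i) → K
  x_ne_y : ∀ i r c, x i r ≠ y i c
  α : K

attribute [instance] CodeData.field

/-- A single program that encodes all the codes with given parameters. It is obtained by encoding
over the product of all fields. -/
theorem exists_uniform_encoder.{u} {ℓ h : ℕ} {k n : Fin ℓ → ℕ} (hk : ∀ i, h ≤ k i)
    (hkn : ∀ i, k i ≤ n i) (hn : ∀ i, 2 ≤ n i) :
    ∃ P : Program (MsgIndex ℓ k) (CodeIndex ℓ h n),
      P.mulCount ≤ ∑ i, cauchyCost (n i) + ℓ * h ∧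
      ∀ θ : CodeData.{u} ℓ k n, ∃ w : ℕ → θ.K, ∀ m,
        (∀ i c, P.eval w m (Sum.inl ⟨i, c⟩) = ∑ r, m ⟨i, r⟩ * (θ.x i r - θ.y i c)⁻¹) ∧
        ∀ c : Fin h, P.eval w m (Sum.inr c)
          = ∑ i : Fin ℓ, m ⟨i, Fin.castLE (hk i) c⟩ * θ.α ^ ((c : ℕ) * i) := by
  obtain ⟨P, w, hP, hw⟩ := exists_encoder (∀ θ : CodeData.{u} ℓ k n, θ.K) hk hkn hn
    (fun i r θ => θ.x i r) (fun i c θ => θ.y i c) (fun i r c θ => (θ.x i r - θ.y i c)⁻¹)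
    (fun i r c => funext fun θ => mul_inv_cancel₀ (sub_ne_zero.2 (θ.x_ne_y i r c)))
    (fun θ => θ.α)
  refine ⟨P, hP, fun θ => ⟨fun j => w j θ, fun m => ?_⟩⟩
  -- Projection to the factor θ is surjective, so each message over that field lifts to the product,
  -- where the program is correct.
  let f := Pi.evalRingHom (fun θ : CodeData.{u} ℓ k n => θ.K) θ
  have hf : Function.Surjective f := Function.surjective_eval θ
  choose g hg using hf
  have hm : m = f ∘ fun a => g (m a) := funext fun a => (hg (m a)).symm
  have hmap := Program.map_eval f P w fun a => g (m a)
  rw [← hm] at hmap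
  have hm' : ∀ a, g (m a) θ = m a := fun a => hg (m a)
  obtain ⟨h₁, h₂⟩ := hw fun a => g (m a)
  refine ⟨fun i c => (hmap _).trans ?_, fun c => (hmap _).trans ?_⟩
  · rw [h₁ i c, map_sum]
    exact sum_congr rfl fun r _ => congrArg₂ _ (hm' _) rfl
  · rw [h₂ c, map_sum]
    exact sum_congr rfl fun r _ => congrArg₂ _ (hm' _) rfl

/-! ### Codeword entries and the final estimate. -/

theorem vecMul_genMatrix_inl {F K : Type*} [Field F] [Field K] [Algebra F K] {ℓ h : ℕ}
    {k n : Fin ℓ → ℕ} (A : (i : Fin ℓ) → Matrix (Fin (k i)) (Fin (n i)) F) (α : K)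
    (m : MsgIndex ℓ k → K) (i : Fin ℓ) (c : Fin (n i)) :
    Matrix.vecMul m (genMatrix h A α) (Sum.inl ⟨i, c⟩)
      = ∑ r, m ⟨i, r⟩ * algebraMap F K (A i r c) := by
  simp only [Matrix.vecMul, dotProduct, genMatrix, Matrix.fromCols_apply_inl]
  rw [Fintype.sum_sigma, sum_eq_single i]
  · simp
  · intro j _ hj
    refine sum_eq_zero fun r _ => ?_
    rw [Matrix.blockDiagonal'_apply_ne _ _ _ hj, mul_zero]
  · simp

theorem vecMul_genMatrix_inr {F K : Type*} [Field F] [Field K] [Algebra F K] {ℓ h : ℕ}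
    {k n : Fin ℓ → ℕ} (hk : ∀ i, h ≤ k i) (A : (i : Fin ℓ) → Matrix (Fin (k i)) (Fin (n i)) F)
    (α : K) (m : MsgIndex ℓ k → K) (c : Fin h) :
    Matrix.vecMul m (genMatrix h A α) (Sum.inr c)
      = ∑ i : Fin ℓ, m ⟨i, Fin.castLE (hk i) c⟩ * α ^ ((c : ℕ) * i) := by
  simp only [Matrix.vecMul, dotProduct, genMatrix, Matrix.fromCols_apply_inr, Matrix.of_apply,
    parityBlock]
  rw [Fintype.sum_sigma]
  refine sum_congr rfl fun i _ => ?_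
  rw [sum_eq_single (Fin.castLE (hk i) c)]
  · simp
  · intro r _ hr
    rw [if_neg, mul_zero]
    intro h'
    exact hr (Fin.ext h')
  · simp

theorem cauchyCost_add_le {n : ℕ} (hn : 2 ≤ n) :
    (cauchyCost n : ℝ) + n ≤ 464164 * (n * Real.log n ^ 2) := by
  have hL : 1 ≤ Nat.clog 2 n := Nat.clog_pos (by norm_num) hn
  have hlt : 2 ^ (Nat.clog 2 n - 1) < n := Nat.pow_pred_clog_lt_self (by norm_num) hn
  unfold cauchyCost
  obtain ⟨L, hL'⟩ : ∃ L, Nat.clog 2 n = L + 1 := ⟨Nat.clog 2 n - 1, by omega⟩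
  rw [hL', Nat.add_sub_cancel] at hlt
  rw [hL']
  have hlt' : (2 : ℝ) ^ L < n := by exact_mod_cast hlt
  have hn' : (2 : ℝ) ≤ n := by exact_mod_cast hn
  have hlog2 : (1 / 2 : ℝ) ≤ Real.log 2 := by
    have := Real.log_two_gt_d9
    linarith
  have h1 : Real.log 2 ≤ Real.log n := Real.log_le_log (by norm_num) hn'
  have h2 : L * Real.log 2 ≤ Real.log n := by
    rw [← Real.log_pow]
    exact Real.log_le_log (by positivity) hlt'.le
  -- Since log 2 ≥ 1/2, both L and 1 are at most 2 log n. With 2^(L+1) ≤ 2n the total constant is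
  -- 14505 · 32 + 4 = 464164, where 4 accounts for the extra n.
  have h3 : (L + 1 : ℝ) ≤ 4 * Real.log n := by
    have : (L : ℝ) * (1 / 2) ≤ L * Real.log 2 := mul_le_mul_of_nonneg_left hlog2 (by positivity)
    linarith
  have h4 : (L + 1 : ℝ) ^ 2 ≤ 16 * Real.log n ^ 2 :=
    calc (L + 1 : ℝ) ^ 2 ≤ (4 * Real.log n) ^ 2 := pow_le_pow_left₀ (by positivity) h3 2
      _ = _ := by ring
  have h5 : (2 : ℝ) ^ (L + 1) ≤ 2 * n := by
    rw [pow_succ]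
    linarith
  have h6 : (2 : ℝ) ^ (L + 1) * (L + 1) ^ 2 ≤ 2 * n * (16 * Real.log n ^ 2) :=
    mul_le_mul h5 h4 (by positivity) (by positivity)
  have h7 : (1 : ℝ) ≤ 4 * Real.log n ^ 2 := by nlinarith
  have h8 : (n : ℝ) * 1 ≤ n * (4 * Real.log n ^ 2) := mul_le_mul_of_nonneg_left h7 (by positivity)
  push_cast
  linarith

end Encoding

end MRLRC

theorem mainTheorem5 :
    ∃ C : ℝ, ∀ (ℓ h : ℕ) (k n : Fin ℓ → ℕ),
      (∀ i, h ≤ k i) → (∀ i, k i ≤ n i) → (∀ i, 2 ≤ n i) →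
      ∃ P : MRLRC.Program (MRLRC.MsgIndex ℓ k) (MRLRC.CodeIndex ℓ h n),
        (P.mulCount : ℝ) ≤ C * ∑ i, (n i : ℝ) * Real.log (n i) ^ 2 ∧
        ∀ (F K : Type*) [Field F] [Finite F] [Field K] [Finite K] [Algebra F K]
          (A : (i : Fin ℓ) → Matrix (Fin (k i)) (Fin (n i)) F) (α : K),
          (∀ i, MRLRC.IsCauchy (A i)) →
          IsPrimitiveRoot α (Nat.card K - 1) →
          (1 < h → (ℓ - 1) * (h / 2) * ((h + 1) / 2) + 1 ≤ Module.finrank F K) →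
          ∃ w : ℕ → K, ∀ m : MRLRC.MsgIndex ℓ k → K,
            P.eval w m = Matrix.vecMul m (MRLRC.genMatrix h A α) := by
  refine ⟨464164, fun ℓ h k n hk hkn hn => ?_⟩
  obtain ⟨P, hP, hw⟩ := MRLRC.exists_uniform_encoder hk hkn hn
  refine ⟨P, ?_, fun F K _ _ _ _ _ A α hA _ _ => ?_⟩
  · calc (P.mulCount : ℝ) ≤ ((∑ i, MRLRC.cauchyCost (n i) + ℓ * h : ℕ) : ℝ) := by
          exact_mod_cast hP
      _ = ∑ i, ((MRLRC.cauchyCost (n i) : ℝ) + h) := by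
          rw [Finset.sum_add_distrib]
          simp
      _ ≤ ∑ i, 464164 * ((n i : ℝ) * Real.log (n i) ^ 2) := by
          refine Finset.sum_le_sum fun i _ => le_trans ?_ (MRLRC.cauchyCost_add_le (hn i))
          -- The ℓh parity multiplications are charged as h to each block and absorbed by n_i.
          have : (h : ℝ) ≤ n i := by exact_mod_cast (hk i).trans (hkn i)
          linarith
      _ = _ := by rw [Finset.mul_sum]
  · choose x y _ _ hxy hentry using hA
    obtain ⟨w, hw⟩ := hw
      { K := K
        x := fun i r => algebraMap F K (x i r)
        y := fun i c => algebraMap F K (y i c)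
        x_ne_y := fun i r c h => hxy i r c ((algebraMap F K).injective h)
        α := α }
    refine ⟨w, fun m => funext fun a => ?_⟩
    obtain ⟨h₁, h₂⟩ := hw m
    rcases a with ⟨i, c⟩ | c
    · rw [MRLRC.vecMul_genMatrix_inl, h₁]
      refine Finset.sum_congr rfl fun r _ => ?_
      rw [hentry, map_inv₀, map_sub]
    · rw [MRLRC.vecMul_genMatrix_inr hk, h₂]
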